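/- **Setting.** Let $R$ be a ring with identity and $(X,\le)$ a finite graded poset: $\dim:X\to\mathbb N$ satisfies $\dim y=\dim x+1$ whenever $y$ covers $x$ (written $x\prec y$). Put $x_+=\{y: x\prec y\}$ and $x_-=\{y: y\prec x\}$. Let $F$ be a cochain complex of finitely generated free $R$-modules parametrized over $X$: modules $F(x)$ with chosen finite bases and linear maps $F_{xy}:F(x)\to F(y)$, zero unless $x\prec y$, such that the maps $d^k:\bigoplus_{\dim x=k}F(x)\to\bigoplus_{\dim y=k+1}F(y)$ with blocks $F_{xy}$ satisfy $d^{k+1}d^k=0$. An *acyclic matching* is a set $\Sigma\subset X\times X$ of pairs $(x,y)$ with $x\prec y$, no element lying in two pairs, such that the transitive closure of the relation $(x,y)\lhd(x',y')\Leftrightarrow x\prec y'$ on $\Sigma$ is a partial order; it is *$F$-compatible* if $F_{xy}$ is invertible for all $(x,y)\in\Sigma$. The *critical* elements are those in no pair. A *gradient path* is a sequence $\gamma=(x_j,y_j)_{j=1}^J$, $J\ge1$, in $\Sigma$ with $x_j\prec y_{j+1}$ and consecutive pairs distinct; it *flows* from $m$ to $m'$ if $m\prec y_1$ and $x_J\prec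 m'$. Its coindex is $F_\gamma=(-F_{x_Jy_J}^{-1})F_{x_{J-1}y_J}\cdots F_{x_1y_2}(-F_{x_1y_1}^{-1})$. The *Morse parametrization* $F^\Sigma$ has the modules $F(m)$, $m$ critical, and the maps $$F^\Sigma_{mm'}=F_{mm'}+\sum_{\gamma}F_{x_Jm'}\circ F_\gamma\circ F_{my_1},$$ the sum being over all gradient paths $\gamma$ flowing from $m$ to $m'$. It lives over the poset of critical elements in which $m'$ covers $m$ iff $m\prec m'$ or some gradient path flows from $m$ to $m'$. **The algorithm Scythe.** While there are non-critical elements: select any minimal non-critical element $c$, mark it critical, and set a queue to $(c)$; while the queue is nonempty, dequeue $y$; if $y_-$ contains exactly one non-critical element $x$, and $F_{xy}$ is invertible, enqueue $x_+\setminus\{y\}$ and call ReducePair$(x,y)$; in any case enqueue $y_+$. Only non-critical elements of dimension $\dim c+1$ that have not been enqueued since the last reset of the queue are enqueued. ReducePair$(x,y)$: for all $z\in x_+\setminus\{y\}$ and $w\in y_-\setminus\{x\}$ set $w\prec z$ and replace $F_{wz}$ by $F_{wz}-F_{xz}F_{xy}^{-1}F_{wy}$; then remove $x$ and $y$ from $X$.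 **Cost model.** Scythe runs on a unit-cost random access machine whose cells hold indices or elements of $R$. The input is given by the list of elements, the lists $x_+$, $x_-$ (in any order), the dimensions and ranks, and the matrices of the $F_{xy}$. Matrix products and inverses (with the test for invertibility) are computed by arithmetic programs over $R$ (ring operations, inversion of units, zero tests, unit cost). Let $\omega$ be such that these programs multiply and invert matrices of size at most $e$ in $O(e^\omega)$ steps, for all $e\ge1$. **Theorem.** For every input, Scythe terminates, and the set $\Sigma$ of pairs $(x,y)$ for which ReducePair is called is an $F$-compatible acyclic matching on $X$. On termination the remaining elements are exactly the critical elements of $\Sigma$, the stored covering relation and matrices are those of the Morse parametrization $F^\Sigma$, and $F^\Sigma$ is a parametrized cochain complex over the graded poset of critical elements. Moreover let $n=|X|$, $p=\max_x|x_+|$, $d=\max_x\operatorname{rank}F(x)$, and $\tilde m=\sum_k m_k^2$, where $m_k$ is the number of critical elements of dimension $k$. There is a constant $C$, depending only on $R$, on the matrix programs and on $\omega$, such that whenever $p\ge1$ and $d\ge1$ the running time is at most $C\,n\,p\,\tilde m\,d^{\omega}$ and the memory used, not counting the internal registers of the matrix programs, is at most $C\,n^2p\,d^2$. If the matrix programs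 use at most $We^2$ registers on matrices of size at most $e$, then the total memory is at most $(C+W)\,n^2p\,d^2$. -/

import Mathlib

universe u v w

noncomputable section

namespace Scythe

/-! ### Parametrized cochain complexes, matchings and Morse data -/

/-- A family of `R`-modules indexed by `X` together with a linear map (a "block") for every
ordered pair of indices. -/
structure BlockData (R : Type u) [Ring R] (X : Type v) where
  obj : X → Type w
  [addCommGroup : ∀ x, AddCommGroup (obj x)]
  [module : ∀ x, Module R (obj x)]
  map : ∀ x y, obj x →ₗ[R] obj y

attribute [instance] BlockData.addCommGroup BlockData.module

/-- The cochain module `Cⁿ = ⨁_{dim x = n} F(x)` (a finite direct sum, written as a product). -/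
abbrev BlockData.Cochain {R : Type u} [Ring R] {X : Type v} (G : BlockData.{u, v, w} R X)
    (dim : X → ℕ) (n : ℕ) : Type (max v w) :=
  ∀ x : {x : X // dim x = n}, G.obj x.1

/-- The operator `dⁿ : Cⁿ → Cⁿ⁺¹` whose block from `F(x)` to `F(y)` is `F_{xy}`. -/
def BlockData.coboundary {R : Type u} [Ring R] {X : Type v} [Finite X]
    (G : BlockData.{u, v, w} R X) (dim : X → ℕ) (n : ℕ) :
    G.Cochain dim n →ₗ[R] G.Cochain dim (n + 1) :=
  letI : Fintype {x : X // dim x = n} := Fintype.ofFinite _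
  LinearMap.pi fun y => ∑ x : {x : X // dim x = n}, G.map x.1 y.1 ∘ₗ LinearMap.proj x

/-- The blocks assemble to a cochain complex: `dⁿ⁺¹ ∘ dⁿ = 0`. -/
def BlockData.IsCochainComplex {R : Type u} [Ring R] {X : Type v} [Finite X]
    (G : BlockData.{u, v, w} R X) (dim : X → ℕ) : Prop :=
  ∀ n, G.coboundary dim (n + 1) ∘ₗ G.coboundary dim n = 0

/-- A cochain complex of `R`-modules parametrized over the finite poset `X` with dimension
function `dim`. -/
structure Parametrization (R : Type u) [Ring R] (X : Type v) [PartialOrder X] [Finite X]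
    (dim : X → ℕ) extends BlockData.{u, v, w} R X where
  map_eq_zero : ∀ x y, ¬ x ⋖ y → map x y = 0
  isCochainComplex : toBlockData.IsCochainComplex dim

section Matching

variable {R : Type u} [Ring R] {X : Type v} [PartialOrder X]

/-- Partial matchings: every pair is a covering pair, and no element lies in two pairs. -/
structure IsPartialMatching (S : Set (X × X)) : Prop where
  dimension : ∀ p ∈ S, p.1 ⋖ p.2
  partition : ∀ p ∈ S, ∀ q ∈ S, p ≠ q → p.1 ≠ q.1 ∧ p.1 ≠ q.2 ∧ p.2 ≠ q.1 ∧ p.2 ≠ q.2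

/-- The relation `(x, y) ⊲ (x', y') ↔ x ≺ y'` on the pairs of `S`. -/
def Lhd (S : Set (X × X)) (p q : X × X) : Prop := p ∈ S ∧ q ∈ S ∧ p.1 ⋖ q.2

/-- Acyclic matchings: the transitive closure of `⊲` (which is reflexive on `S`) is
antisymmetric, hence a partial order. -/
structure IsAcyclicMatching (S : Set (X × X)) : Prop extends IsPartialMatching S where
  acyclic : ∀ p q, Relation.TransGen (Lhd S) p q → Relation.TransGen (Lhd S) q p → p = q

/-- Compatibility with the blocks: `F_{xy}` is invertible for every matched pair `(x, y)`. -/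
def IsCompatible (G : BlockData.{u, v, w} R X) (S : Set (X × X)) : Prop :=
  ∀ p ∈ S, Function.Bijective (G.map p.1 p.2)

/-- Critical, i.e. unpaired, elements. -/
def IsCritical (S : Set (X × X)) (m : X) : Prop := ∀ z, (m, z) ∉ S ∧ (z, m) ∉ S

/-- The inverse of a bijective linear map (and `0` for other maps). -/
def linInv {M N : Type w} [AddCommGroup M] [Module R M] [AddCommGroup N] [Module R N]
    (f : M →ₗ[R] N) : N →ₗ[R] M :=
  open Classical in
  if h : Function.Bijective f then ((LinearEquiv.ofBijective f h).symm : N →ₗ[R] M) else 0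

/-- The nonempty sequence of pairs `p, l₁, l₂, …` is a gradient path
`y₁ ≻ x₁ ≺ y₂ ≻ x₂ ≺ ⋯ ≺ y_J ≻ x_J`, strictly increasing for `⊲`. -/
def IsGradientPath (S : Set (X × X)) (p : X × X) (l : List (X × X)) : Prop :=
  (∀ q ∈ p :: l, q ∈ S) ∧ List.IsChain (fun a b : X × X => a ≠ b ∧ a.1 ⋖ b.2) (p :: l)

/-- The last pair of the sequence `p, l₁, l₂, …`. -/
def lastPair (p : X × X) : List (X × X) → X × X
  | [] => p
  | q :: l => lastPair q l

/-- The coindex `F_γ : F(y₁) → F(x_J)` of the path `γ = p, l₁, l₂, …`. -/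
def coindex (G : BlockData.{u, v, w} R X) (p : X × X) :
    (l : List (X × X)) → (G.obj p.2 →ₗ[R] G.obj (lastPair p l).1)
  | [] => -linInv (G.map p.1 p.2)
  | q :: l => coindex G q l ∘ₗ G.map p.1 q.2 ∘ₗ (-linInv (G.map p.1 p.2))

/-- The path `p, l₁, l₂, …` is a gradient path flowing from `m` to `m'`. -/
def FlowsFromTo (S : Set (X × X)) (m m' : X) (p : X × X) (l : List (X × X)) : Prop :=
  IsGradientPath S p l ∧ m ⋖ p.2 ∧ (lastPair p l).1 ⋖ m'

/-- `F^Σ_{mm'}`: the block `F_{mm'}` plus the contributions of all gradient paths flowing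
from `m` to `m'`. For an acyclic matching there are finitely many such paths. -/
def morseMap (G : BlockData.{u, v, w} R X) (S : Set (X × X)) (m m' : X) :
    G.obj m →ₗ[R] G.obj m' :=
  G.map m m' + ∑ᶠ (γ : (X × X) × List (X × X)) (_ : FlowsFromTo S m m' γ.1 γ.2),
    G.map (lastPair γ.1 γ.2).1 m' ∘ₗ coindex G γ.1 γ.2 ∘ₗ G.map m γ.1.2

/-- The Morse data `F^Σ`, indexed by the critical elements. -/
def morseData (G : BlockData.{u, v, w} R X) (S : Set (X × X)) :
    BlockData.{u, v, w} R {m : X // IsCritical S m} where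
  obj m := G.obj m.1
  map m m' := morseMap G S m.1 m'.1

/-- The covering relation of the poset of critical elements: `m ≺ m'` held already, or some
gradient path flows from `m` to `m'`. -/
def MorseCovers (S : Set (X × X)) (m m' : X) : Prop :=
  m ⋖ m' ∨ ∃ p l, FlowsFromTo S m m' p l

/-- The order `≤_Σ` on critical elements generated by `MorseCovers`. -/
def MorseLE (S : Set (X × X)) (m m' : {m : X // IsCritical S m}) : Prop :=
  Relation.ReflTransGen (fun a b : {m : X // IsCritical S m} => MorseCovers S a.1 b.1) m m'

end Matching

/-! ### Arithmetic programs over `R` and matrix arithmetic -/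

/-- Arithmetic programs (algebraic computation trees) over the ring `R` with `s` registers.
Program text refers to ring elements only through registers. Each instruction takes one step. -/
inductive Prog (R : Type u) (s : ℕ) : Type u
  /-- stop and output the contents of the listed registers -/
  | ret (out : List (Fin s)) : Prog R s
  /-- stop and report failure -/
  | fail : Prog R s
  | const (dst : Fin s) (a : R) (k : Prog R s) : Prog R s
  | add (dst i j : Fin s) (k : Prog R s) : Prog R s
  | sub (dst i j : Fin s) (k : Prog R s) : Prog R s
  | mul (dst i j : Fin s) (k : Prog R s) : Prog R s
  /-- if register `i` holds a unit, write its inverse to `dst` and go to `k`, else go to `k'` -/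
  | inv (dst i : Fin s) (k k' : Prog R s) : Prog R s
  /-- if register `i` holds `0`, go to `k`, else go to `k'` -/
  | ifZero (i : Fin s) (k k' : Prog R s) : Prog R s

namespace Prog

variable {R : Type u} {s : ℕ}

/-- Running a program on a register content. -/
def eval [Ring R] : Prog R s → (Fin s → R) → Option (List R)
  | ret out, m => some (out.map m)
  | fail, _ => none
  | const dst a k, m => k.eval (Function.update m dst a)
  | add dst i j k, m => k.eval (Function.update m dst (m i + m j))
  | sub dst i j k, m => k.eval (Function.update m dst (m i - m j))
  | mul dst i j k, m => k.eval (Function.update m dst (m i * m j))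
  | inv dst i k k', m =>
      open Classical in
      if IsUnit (m i) then k.eval (Function.update m dst (Ring.inverse (m i))) else k'.eval m
  | ifZero i k k', m =>
      open Classical in
      if m i = 0 then k.eval m else k'.eval m

/-- Worst-case number of steps; writing an output takes one step per entry. -/
def cost : Prog R s → ℕ
  | ret out => out.length + 1
  | fail => 1
  | const _ _ k => k.cost + 1
  | add _ _ _ k => k.cost + 1
  | sub _ _ _ k => k.cost + 1
  | mul _ _ _ k => k.cost + 1
  | inv _ _ k k' => max k.cost k'.cost + 1
  | ifZero _ k k' => max k.cost k'.cost + 1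

/-- Running a program on an input list, which is placed in the first registers; the other
registers hold `0`. -/
def run [Ring R] (P : Prog R s) (input : List R) : Option (List R) :=
  P.eval fun i => input.getD i 0

end Prog

section Entries

variable {R : Type u}

/-- The entries of a matrix, row by row. -/
def entries {a b : ℕ} (A : Matrix (Fin a) (Fin b) R) : List R :=
  (List.ofFn fun i => List.ofFn fun j => A i j).flatten

/-- The upper left `a × b` block of the matrix with rows of length `c` listed in `l`. -/
def ofEntries [Zero R] (a b c : ℕ) (l : List R) : Matrix (Fin a) (Fin b) R :=
  Matrix.of fun i j => l.getD (i * c + j) 0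

/-- Padding with zeros to an `e × e` matrix. -/
def pad [Zero R] {a b : ℕ} (e : ℕ) (A : Matrix (Fin a) (Fin b) R) : Matrix (Fin e) (Fin e) R :=
  Matrix.of fun i j => if h : i.1 < a ∧ j.1 < b then A ⟨i, h.1⟩ ⟨j, h.2⟩ else 0

end Entries

/-- The matrix arithmetic used by the algorithm: for every `e` a program that multiplies
two `e × e` matrices over `R`, and for all `a, b` a program that decides whether an `a × b`
matrix is invertible and outputs its inverse if it is. -/
structure MatrixKit (R : Type u) [Ring R] where
  mulRegs : ℕ → ℕ
  mul : ∀ e, Prog R (mulRegs e)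
  mul_run : ∀ e (A B : Matrix (Fin e) (Fin e) R),
    (mul e).run (entries A ++ entries B) = some (entries (A * B))
  invRegs : ℕ → ℕ → ℕ
  inv : ∀ a b, Prog R (invRegs a b)
  inv_run_some : ∀ a b (A : Matrix (Fin a) (Fin b) R) (B : Matrix (Fin b) (Fin a) R),
    A * B = 1 → B * A = 1 → (inv a b).run (entries A) = some (entries B)
  inv_run_none : ∀ a b (A : Matrix (Fin a) (Fin b) R),
    (¬ ∃ B : Matrix (Fin b) (Fin a) R, A * B = 1 ∧ B * A = 1) →
      (inv a b).run (entries A) = none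

namespace MatrixKit

variable {R : Type u} [Ring R] (kit : MatrixKit R)

/-- Multiplication and inversion of matrices of size at most `e` take `O(e ^ ω)` steps. -/
def HasExponent (ω : ℝ) : Prop :=
  ∃ K : ℝ, ∀ e : ℕ, 1 ≤ e → ((kit.mul e).cost : ℝ) ≤ K * (e : ℝ) ^ ω ∧
    ∀ a b, a ≤ e → b ≤ e → ((kit.inv a b).cost : ℝ) ≤ K * (e : ℝ) ^ ω

/-- Multiplication and inversion of matrices of size at most `e` use at most `W * e ^ 2`
registers. -/
def HasWorkspace (W : ℕ) : Prop :=
  ∀ e : ℕ, 1 ≤ e → kit.mulRegs e ≤ W * e ^ 2 ∧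
    ∀ a b, a ≤ e → b ≤ e → kit.invRegs a b ≤ W * e ^ 2

/-- The size at which a rectangular product is computed. -/
def mulSize (a b c : ℕ) : ℕ := max a (max b c)

/-- Rectangular product: pad with zeros, run the square program, cut out the result. -/
def mulRect {a b c : ℕ} (A : Matrix (Fin a) (Fin b) R) (B : Matrix (Fin b) (Fin c) R) :
    Matrix (Fin a) (Fin c) R :=
  let e := mulSize a b c
  ofEntries a c e (((kit.mul e).run (entries (pad e A) ++ entries (pad e B))).getD [])

/-- Steps of `mulRect`: load the padded factors, run the program, copy the result. -/
def mulTime (a b c : ℕ) : ℕ :=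
  2 * mulSize a b c ^ 2 + (kit.mul (mulSize a b c)).cost + a * c

/-- Inversion test and inverse of an `a × b` matrix. -/
def invRect {a b : ℕ} (A : Matrix (Fin a) (Fin b) R) : Option (Matrix (Fin b) (Fin a) R) :=
  ((kit.inv a b).run (entries A)).map (ofEntries b a a)

/-- Steps of `invRect`: load the matrix, run the program, copy the result. -/
def invTime (a b : ℕ) : ℕ := a * b + (kit.inv a b).cost + b * a

end MatrixKit

/-! ### Input -/

/-- `p`, the maximal number of covers of an element. -/
def maxCovers (X : Type v) [PartialOrder X] [Fintype X] : ℕ :=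
  Finset.univ.sup fun x : X => Set.ncard {y : X | x ⋖ y}

/-- An input: a finite graded poset `X`, given by a list of its elements and the lists
`x₊` and `x₋` of covers and of covered elements (each in an arbitrary order), and a cochain
complex of free `R`-modules parametrized over `X`, given by a basis of each `F(x)`. -/
structure Input (R : Type u) [Ring R] (X : Type v) [PartialOrder X] [Finite X] where
  dim : X → ℕ
  dim_covBy : ∀ x y, x ⋖ y → dim y = dim x + 1
  F : Parametrization.{u, v, w} R X dim
  rank : X → ℕ
  basis : ∀ x, Module.Basis (Fin (rank x)) R (F.obj x)
  elems : List X
  nodup_elems : elems.Nodup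
  mem_elems : ∀ x, x ∈ elems
  up : X → List X
  nodup_up : ∀ x, (up x).Nodup
  mem_up : ∀ x y, y ∈ up x ↔ x ⋖ y
  down : X → List X
  nodup_down : ∀ y, (down y).Nodup
  mem_down : ∀ x y, x ∈ down y ↔ x ⋖ y

namespace Input

variable {R : Type u} [Ring R] {X : Type v} [PartialOrder X] [Fintype X]
  (I : Input.{u, v, w} R X)

/-- The matrix of a linear map `F(x) → F(y)`: row `i` holds the coordinates of the image of the
`i`-th basis vector. With this convention `g ∘ f` has the matrix `[f] * [g]`, also over
noncommutative rings. -/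
def matrixOf {x y : X} (f : I.F.obj x →ₗ[R] I.F.obj y) :
    Matrix (Fin (I.rank x)) (Fin (I.rank y)) R :=
  Matrix.of fun i j => (I.basis y).repr (f (I.basis x i)) j

/-- `d`, the maximal rank of a module `F(x)`. -/
def maxRank : ℕ := Finset.univ.sup I.rank

/-- `m̃ = ∑ₖ mₖ²`, where `mₖ` is the number of critical elements of dimension `k`. -/
def critSq (S : Set (X × X)) : ℕ :=
  ∑ k ∈ Finset.univ.image I.dim, Set.ncard {x : X | IsCritical S x ∧ I.dim x = k} ^ 2

end Input

/-! ### The algorithm -/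

/-- The memory of the algorithm, together with counters for the time used so far, the peak
memory used so far, and the peak number of registers used inside matrix subroutines. -/
structure Store (R : Type u) (X : Type v) (rank : X → ℕ) where
  /-- has not been removed from `X` -/
  alive : X → Bool
  /-- has been marked as critical -/
  crit : X → Bool
  /-- has been enqueued since the queue was last reinitialized -/
  queued : X → Bool
  /-- the number of non-critical elements of `x₋` -/
  cnt : X → ℕ
  /-- the list of `x₊`; removed elements may remain in it -/
  up : X → List X
  /-- the list of `x₋`; removed elements may remain in it -/
  down : X → List X
  /-- the matrix of `F_{xy}`, stored if `x ≺ y` -/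
  blk : ∀ x y, Option (Matrix (Fin (rank x)) (Fin (rank y)) R)
  queue : List X
  /-- the pairs for which `ReducePair` has been called -/
  pairs : List (X × X)
  time : ℕ
  mem : ℕ
  work : ℕ

namespace Store

variable {R : Type u} {X : Type v} {rank : X → ℕ}

/-- The number of memory cells occupied: for each `x` a cell for the list of elements, the
dimension, the rank, the three flags, the counter, and the heads and the tails of the two
adjacency lists; two cells for each list node; a table of pointers indexed by `X × X` and one
cell for each entry of a stored matrix; the queue, the list of pairs and the loop variables. -/
def size [Fintype X] (s : Store R X rank) : ℕ :=
  (∑ x, (11 + 2 * (s.up x).length + 2 * (s.down x).length)) +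
  (∑ x, ∑ y, (1 + if (s.blk x y).isSome then rank x * rank y else 0)) +
  2 * s.queue.length + 3 * s.pairs.length + 10

/-- Account for `t` steps, during which `extra` cells are used for temporary data. -/
def charge [Fintype X] (s : Store R X rank) (t extra : ℕ) : Store R X rank :=
  { s with time := s.time + t, mem := max s.mem (s.size + extra) }

/-- Account for the use of `regs` registers by a matrix subroutine. -/
def useWork (s : Store R X rank) (regs : ℕ) : Store R X rank :=
  { s with work := max s.work regs }

variable [Fintype X] [DecidableEq X]

/-- Lower the counter of each element of a list by one. -/
def decr (l : List X) (s : Store R X rank) : Store R X rank :=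
  l.foldl (fun s z => ({ s with cnt := Function.update s.cnt z (s.cnt z - 1) }).charge 1 0) s

/-- Mark `c` as critical. -/
def mark (c : X) (s : Store R X rank) : Store R X rank :=
  decr (s.up c) (({ s with crit := Function.update s.crit c true }).charge 1 0)

/-- Remove `x` (which is not critical) from `X`. -/
def remove (x : X) (s : Store R X rank) : Store R X rank :=
  decr (s.up x) (({ s with alive := Function.update s.alive x false }).charge 1 0)

/-- Set the queue to `[c]`, clear all other flags. -/
def resetQueue (c : X) (s : Store R X rank) : Store R X rank :=
  ({ s with
      queue := [c]
      queued := Function.update (fun _ => false) c true }).charge (Fintype.card X + 2) 0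

/-- Enqueue those elements of a list which are present, are not critical, have not been enqueued
since the last reset and have dimension `k + 1`. -/
def enqueue (dim : X → ℕ) (k : ℕ) (l : List X) (s : Store R X rank) : Store R X rank :=
  l.foldl (fun s z =>
    if s.alive z && !s.crit z && !s.queued z && decide (dim z = k + 1) then
      ({ s with queue := s.queue ++ [z], queued := Function.update s.queued z true }).charge 1 0
    else s.charge 1 0) s

/-- Set `w ≺ z`. -/
def setCover (w z : X) (s : Store R X rank) : Store R X rank :=
  if (s.blk w z).isSome then s
  else
    { s with
      up := Function.update s.up w (s.up w ++ [z])
      down := Function.update s.down z (s.down z ++ [w]) }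

/-- Store a matrix as `F_{wz}`. -/
def setBlk (w z : X) (A : Matrix (Fin (rank w)) (Fin (rank z)) R) (s : Store R X rank) :
    Store R X rank :=
  { s with blk := Function.update s.blk w (Function.update (s.blk w) z (some A)) }

variable [Ring R]

/-- The matrix `F_{xy}`, which is `0` if nothing is stored. -/
def getBlk (s : Store R X rank) (x y : X) : Matrix (Fin (rank x)) (Fin (rank y)) R :=
  (s.blk x y).getD 0

/-- Set `w ≺ z` and replace `F_{wz}` by `F_{wz} - F_{xz} ∘ F_{xy}⁻¹ ∘ F_{wy}`, where `B` is the
matrix of `F_{xy}⁻¹`. The caller holds `extra` cells of temporary data. -/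
def updateBlk (kit : MatrixKit R) (x y : X) (B : Matrix (Fin (rank y)) (Fin (rank x)) R)
    (extra : ℕ) (z w : X) (s : Store R X rank) : Store R X rank :=
  let P := kit.mulRect (s.getBlk w y) B
  let Q := kit.mulRect P (s.getBlk x z)
  let e₁ := MatrixKit.mulSize (rank w) (rank y) (rank x)
  let e₂ := MatrixKit.mulSize (rank w) (rank x) (rank z)
  let s := (s.useWork (kit.mulRegs e₁)).useWork (kit.mulRegs e₂)
  (setBlk w z (s.getBlk w z - Q) (setCover w z s)).charge
    (kit.mulTime (rank w) (rank y) (rank x) + kit.mulTime (rank w) (rank x) (rank z)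
      + rank w * rank z + 3)
    (extra + rank w * rank x + rank w * rank z + 2 * e₁ ^ 2 + 2 * e₂ ^ 2)

/-- `ReducePair(x, y)`; `low` lists the present elements of `y₋`, and `B` is the matrix of
`F_{xy}⁻¹`. -/
def reducePair (kit : MatrixKit R) (x y : X) (B : Matrix (Fin (rank y)) (Fin (rank x)) R)
    (low : List X) (s : Store R X rank) : Store R X rank :=
  let zs := (s.up x).filter fun z => s.alive z && decide (z ≠ y)
  let ws := low.filter fun w => decide (w ≠ x)
  let extra := 2 * zs.length + 2 * ws.length + 2 * low.length + rank y * rank x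
  let s := s.charge ((s.up x).length + low.length + 1) extra
  let s := zs.foldl (fun s z =>
    ws.foldl (fun s w => updateBlk kit x y B extra z w s) (s.charge 1 extra)) s
  let s := remove y (remove x s)
  ({ s with pairs := (x, y) :: s.pairs }).charge 1 0

/-- One pass of the inner loop for the element `y`, which has just been dequeued: if exactly one
element `x` of `y₋` is not critical, and `F_{xy}` is invertible, then enqueue `x₊ \ {y}` (`y`
itself carries a flag and is not enqueued again) and call `ReducePair(x, y)`. In any case enqueue
`y₊`. -/
def process (kit : MatrixKit R) (dim : X → ℕ) (k : ℕ) (y : X) (s : Store R X rank) :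
    Store R X rank :=
  let low := (s.down y).filter fun x => s.alive x
  let nonCrit := low.filter fun x => !s.crit x
  let extra := 2 * low.length + 2 * nonCrit.length
  let s := s.charge ((s.down y).length + low.length + 1) extra
  let s :=
    match nonCrit with
    | [x] =>
      let s := (s.useWork (kit.invRegs (rank x) (rank y))).charge
        (kit.invTime (rank x) (rank y)) (extra + 2 * (rank x * rank y))
      match kit.invRect (s.getBlk x y) with
      | some B => reducePair kit x y B low (enqueue dim k (s.up x) s)
      | none => s
    | _ => s
  enqueue dim k (s.up y) s

/-- The inner loop. The first argument bounds the number of passes; the result is `none` if the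
loop has not ended within this bound. -/
def innerLoop (kit : MatrixKit R) (dim : X → ℕ) (k : ℕ) :
    ℕ → Store R X rank → Option (Store R X rank)
  | 0, _ => none
  | N + 1, s =>
    match s.queue with
    | [] => some (s.charge 1 0)
    | y :: q => innerLoop kit dim k N (process kit dim k y (({ s with queue := q }).charge 1 0))

/-- The outer loop, with the same convention. Scan the list of elements for a minimal
non-critical element `c`; if there is none, stop, otherwise mark `c` as critical and run the
inner loop from `c`. -/
def outerLoop (kit : MatrixKit R) (dim : X → ℕ) (elems : List X) (M : ℕ) :
    ℕ → Store R X rank → Option (Store R X rank)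
  | 0, _ => none
  | N + 1, s =>
    let s := s.charge (elems.length + 1) 0
    match elems.find? fun x => s.alive x && !s.crit x && decide (s.cnt x = 0) with
    | none => some s
    | some c =>
      (innerLoop kit dim (dim c) M (resetQueue c (mark c s))).bind (outerLoop kit dim elems M N)

end Store

namespace Input

variable {R : Type u} [Ring R] {X : Type v} [PartialOrder X] [Fintype X] [DecidableEq X]
  (I : Input.{u, v, w} R X)

/-- The memory at the start, holding the input. -/
def load : Store R X I.rank where
  alive _ := true
  crit _ := false
  queued _ := false
  cnt _ := 0
  up := I.up
  down := I.down
  blk x y := open Classical in if x ⋖ y then some (I.matrixOf (I.F.map x y)) else none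
  queue := []
  pairs := []
  time := 0
  mem := 0
  work := 0

/-- Initialize the counters: at first all elements of `x₋` are non-critical. -/
def initCounters (s : Store R X I.rank) : Store R X I.rank :=
  I.elems.foldl (fun s x =>
    ({ s with cnt := Function.update s.cnt x (s.down x).length }).charge
      ((s.down x).length + 1) 0) (s.charge 0 0)

/-- The algorithm `Scythe`, run with at most `N` passes of each loop; the result is `none` if
it has not terminated within this bound. -/
def scythe (kit : MatrixKit R) (N : ℕ) : Option (Store R X I.rank) :=
  Store.outerLoop kit I.dim I.elems N N (I.initCounters I.load)

end Input

end Scythe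

end

open Scythe

/-!
When the algorithm reduces a pair `(x, y)`, the only non-critical element that is still present
below `y` is `x`. An element that stays non-critical therefore never lies below the upper element
of a reduced pair, so `(x, y)` can only be the last pair of a gradient path through the pairs
reduced so far. Adding `(x, y)` to the matching thus adds `-F_{xm'} F_{xy}⁻¹ F_{my}`, formed from
the current Morse maps, to the Morse map from `m` to `m'`. This is one step of Gaussian elimination,
the Schur complement that `ReducePair` stores, and it preserves the identity `d ∘ d = 0`.
Acyclicity and compatibility of the matching also follow one pair at a time.

For the running time, the elements other than `x` below `y` are critical elements of one
dimension, so a reduction performed while there are `m` of them takes at most `p * m` matrix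
products. Every element is dequeued at most once between two choices of a critical element, so the
work between the choice of the `m`-th critical element of dimension `k` and the next choice is
`O(n p m d ^ ω)`, and the sum of all these `m` is at most `∑ m_k ^ 2`. For the memory, lists never
hold repetitions, and at most `n ^ 2` matrices are stored.
-/

noncomputable section

namespace Scythe

/-! ### Gradient paths and the Morse data of a matching with one more pair -/

theorem lastPair_concat {X : Type*} (p q : X × X) (l : List (X × X)) :
    lastPair p (l ++ [q]) = q := by
  induction l generalizing p with
  | nil => rfl
  | cons r _ ih => exact ih r

section GradientPaths

variable {X : Type v} [PartialOrder X] {S : Set (X × X)} {p q : X × X} {l : List (X × X)}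
  {m m' : X}

theorem isGradientPath_nil : IsGradientPath S p [] ↔ p ∈ S := by
  simp [IsGradientPath]

theorem isGradientPath_cons :
    IsGradientPath S p (q :: l) ↔ p ∈ S ∧ p ≠ q ∧ p.1 ⋖ q.2 ∧ IsGradientPath S q l := by
  simp only [IsGradientPath, List.mem_cons, List.isChain_cons_cons, forall_eq_or_imp]
  tauto

theorem IsGradientPath.head_mem (h : IsGradientPath S p l) : p ∈ S :=
  h.1 p (by simp)

theorem IsGradientPath.lastPair_mem (h : IsGradientPath S p l) : lastPair p l ∈ S := by
  induction l generalizing p with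
  | nil => exact isGradientPath_nil.1 h
  | cons q l ih => exact ih (isGradientPath_cons.1 h).2.2.2

theorem IsGradientPath.mono {T : Set (X × X)} (hST : S ⊆ T) (h : IsGradientPath S p l) :
    IsGradientPath T p l :=
  ⟨fun q hq => hST (h.1 q hq), h.2⟩

theorem IsGradientPath.concat (h : IsGradientPath S p l) (hq : q ∉ S)
    (hl : (lastPair p l).1 ⋖ q.2) : IsGradientPath (insert q S) p (l ++ [q]) := by
  induction l generalizing p with
  | nil =>
    have hp := isGradientPath_nil.1 h
    have hpq : p ≠ q := fun e => hq (e ▸ hp)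
    exact isGradientPath_cons.2 ⟨Or.inr hp, hpq, hl, isGradientPath_nil.2 (Or.inl rfl)⟩
  | cons r l ih =>
    obtain ⟨hp, hpr, hcov, hr⟩ := isGradientPath_cons.1 h
    exact isGradientPath_cons.2 ⟨Or.inr hp, hpr, hcov, ih hr hl⟩

theorem IsGradientPath.of_insert (hfree : ∀ r ∈ S, ¬ q.1 ⋖ r.2)
    (h : IsGradientPath (insert q S) p l) :
    IsGradientPath S p l ∨ (p = q ∧ l = []) ∨
      ∃ l', l = l' ++ [q] ∧ IsGradientPath S p l' ∧ (lastPair p l').1 ⋖ q.2 := by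
  induction l generalizing p with
  | nil =>
    rcases isGradientPath_nil.1 h with rfl | hp
    · exact Or.inr (Or.inl ⟨rfl, rfl⟩)
    · exact Or.inl (isGradientPath_nil.2 hp)
  | cons r l ih =>
    obtain ⟨rfl | hp, hpr, hcov, hr⟩ := isGradientPath_cons.1 h
    · exact absurd hcov (hfree r (hr.head_mem.resolve_left hpr.symm))
    · rcases ih hr with hr | ⟨rfl, rfl⟩ | ⟨l', rfl, hr, hlast⟩
      · exact Or.inl (isGradientPath_cons.2 ⟨hp, hpr, hcov, hr⟩)
      · exact Or.inr (Or.inr ⟨[], rfl, isGradientPath_nil.2 hp, hcov⟩)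
      · exact Or.inr (Or.inr ⟨r :: l', rfl, isGradientPath_cons.2 ⟨hp, hpr, hcov, hr⟩, hlast⟩)

theorem flowsFromTo_insert (hq : q ∉ S) (hfree : ∀ r ∈ S, ¬ q.1 ⋖ r.2) :
    FlowsFromTo (insert q S) m m' p l ↔ FlowsFromTo S m m' p l ∨
      (q.1 ⋖ m' ∧ ((p = q ∧ l = [] ∧ m ⋖ q.2) ∨
        ∃ l', l = l' ++ [q] ∧ FlowsFromTo S m q.2 p l')) := by
  constructor
  · rintro ⟨hpath, hm, hm'⟩
    rcases hpath.of_insert hfree with h | ⟨rfl, rfl⟩ | ⟨l', rfl, h, hlast⟩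
    · exact Or.inl ⟨h, hm, hm'⟩
    · exact Or.inr ⟨hm', Or.inl ⟨rfl, rfl, hm⟩⟩
    · rw [lastPair_concat] at hm'
      exact Or.inr ⟨hm', Or.inr ⟨l', rfl, h, hm, hlast⟩⟩
  · rintro (⟨h, hm, hm'⟩ | ⟨hm', (⟨rfl, rfl, hm⟩ | ⟨l', rfl, h, hm, hlast⟩)⟩)
    · exact ⟨h.mono (Set.subset_insert _ _), hm, hm'⟩
    · exact ⟨isGradientPath_nil.2 (Or.inl rfl), hm, hm'⟩
    · exact ⟨h.concat hq hlast, hm, by rwa [lastPair_concat]⟩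

theorem morseCovers_insert (hq : q ∉ S) (hfree : ∀ r ∈ S, ¬ q.1 ⋖ r.2) :
    MorseCovers (insert q S) m m' ↔ MorseCovers S m m' ∨ (q.1 ⋖ m' ∧ MorseCovers S m q.2) := by
  simp only [MorseCovers, flowsFromTo_insert hq hfree]
  constructor
  · rintro (h | ⟨p, l, h | ⟨h, (⟨rfl, rfl, h'⟩ | ⟨l', rfl, h'⟩)⟩⟩)
    · exact Or.inl (Or.inl h)
    · exact Or.inl (Or.inr ⟨p, l, h⟩)
    · exact Or.inr ⟨h, Or.inl h'⟩
    · exact Or.inr ⟨h, Or.inr ⟨p, l', h'⟩⟩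
  · rintro ((h | ⟨p, l, h⟩) | ⟨h, (h' | ⟨p, l, h'⟩)⟩)
    · exact Or.inl h
    · exact Or.inr ⟨p, l, Or.inl h⟩
    · exact Or.inr ⟨q, [], Or.inr ⟨h, Or.inl ⟨rfl, rfl, h'⟩⟩⟩
    · exact Or.inr ⟨p, l ++ [q], Or.inr ⟨h, Or.inr ⟨l, rfl, h'⟩⟩⟩

theorem not_flowsFromTo_of_free (hfree : ∀ r ∈ S, ¬ m ⋖ r.2) : ¬ FlowsFromTo S m m' p l :=
  fun h => hfree p h.1.head_mem h.2.1

theorem morseCovers_of_free (hfree : ∀ r ∈ S, ¬ m ⋖ r.2) : MorseCovers S m m' ↔ m ⋖ m' := by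
  simp [MorseCovers, not_flowsFromTo_of_free hfree]

/-- The gradient paths flowing from `m` to `m'`, as a set of nonempty sequences. -/
def flowSet (S : Set (X × X)) (m m' : X) : Set ((X × X) × List (X × X)) :=
  {γ | FlowsFromTo S m m' γ.1 γ.2}

/-- The gradient paths of `insert q S` that leave `m` and have `q` as their last pair, for a pair
`q` that can only occur at the end of a path. -/
def flowSetThrough (S : Set (X × X)) (q : X × X) (m : X) : Set ((X × X) × List (X × X)) :=
  {γ | γ = (q, []) ∧ m ⋖ q.2} ∪ (fun γ => (γ.1, γ.2 ++ [q])) '' flowSet S m q.2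

theorem flowSet_of_free (hfree : ∀ r ∈ S, ¬ m ⋖ r.2) : flowSet S m m' = ∅ :=
  Set.eq_empty_of_forall_notMem fun _ h => not_flowsFromTo_of_free hfree h

theorem flowSet_insert_of_not_covBy (hq : q ∉ S) (hfree : ∀ r ∈ S, ¬ q.1 ⋖ r.2)
    (hm' : ¬ q.1 ⋖ m') : flowSet (insert q S) m m' = flowSet S m m' := by
  simp only [flowSet, flowsFromTo_insert hq hfree, hm', false_and, or_false]

theorem flowSet_insert_of_covBy (hq : q ∉ S) (hfree : ∀ r ∈ S, ¬ q.1 ⋖ r.2) (hm' : q.1 ⋖ m') :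
    flowSet (insert q S) m m' = flowSet S m m' ∪ flowSetThrough S q m := by
  ext ⟨p, l⟩
  simp only [flowSet, flowSetThrough, Set.mem_ofPred_eq, flowsFromTo_insert hq hfree, hm',
    Set.mem_union, Set.mem_image, Prod.mk.injEq, true_and]
  refine or_congr Iff.rfl (or_congr and_assoc.symm ⟨?_, ?_⟩)
  · rintro ⟨l', rfl, h⟩
    exact ⟨(p, l'), h, rfl, rfl⟩
  · rintro ⟨⟨p', l'⟩, h, rfl, rfl⟩
    exact ⟨l', rfl, h⟩

theorem finite_flowSetThrough (hfin : (flowSet S m q.2).Finite) : (flowSetThrough S q m).Finite :=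
  ((Set.finite_singleton (q, [])).subset fun _ h => h.1).union (hfin.image _)

theorem finite_flowSet_insert (hq : q ∉ S) (hfree : ∀ r ∈ S, ¬ q.1 ⋖ r.2)
    (hfin : ∀ m', (flowSet S m m').Finite) (m' : X) : (flowSet (insert q S) m m').Finite := by
  by_cases hm' : q.1 ⋖ m'
  · rw [flowSet_insert_of_covBy hq hfree hm']
    exact (hfin m').union (finite_flowSetThrough (hfin q.2))
  · rw [flowSet_insert_of_not_covBy hq hfree hm']
    exact hfin m'

theorem disjoint_flowSet_flowSetThrough (hq : q ∉ S) :
    Disjoint (flowSet S m m') (flowSetThrough S q m) := by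
  have hlast : ∀ γ ∈ flowSet S m m', lastPair γ.1 γ.2 ≠ q :=
    fun γ h e => hq (e ▸ h.1.lastPair_mem)
  rw [Set.disjoint_left]
  rintro γ h (⟨rfl, -⟩ | ⟨γ', -, rfl⟩)
  · exact hlast _ h rfl
  · exact hlast _ h (lastPair_concat _ _ _)

end GradientPaths

section MorseMap

variable {R : Type u} [Ring R] {X : Type v}

/-- The map `F(y₁) → F(m')` along a path `γ` starting with `(x₁, y₁)`: the coindex of `γ` followed
by the block from the end of `γ` to `m'`. -/
def pathMap (G : BlockData.{u, v, w} R X) (m' : X) (p : X × X) (l : List (X × X)) :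
    G.obj p.2 →ₗ[R] G.obj m' :=
  G.map (lastPair p l).1 m' ∘ₗ coindex G p l

theorem pathMap_cons (G : BlockData.{u, v, w} R X) (m' : X) (p q : X × X) (l : List (X × X)) :
    pathMap G m' p (q :: l) =
      pathMap G m' q l ∘ₗ G.map p.1 q.2 ∘ₗ (-linInv (G.map p.1 p.2)) :=
  rfl

theorem pathMap_concat (G : BlockData.{u, v, w} R X) (m' : X) (p q : X × X)
    (l : List (X × X)) :
    pathMap G m' p (l ++ [q]) =
      (G.map q.1 m' ∘ₗ (-linInv (G.map q.1 q.2))) ∘ₗ pathMap G q.2 p l := by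
  induction l generalizing p with
  | nil => rfl
  | cons r l ih =>
    rw [List.cons_append, pathMap_cons, ih, pathMap_cons]
    rfl

theorem comp_finsum_mem {ι A M N P : Type*} [Semiring A] [AddCommMonoid M] [AddCommMonoid N]
    [AddCommMonoid P] [Module A M] [Module A N] [Module A P] (g : N →ₗ[A] P) {s : Set ι}
    (hs : s.Finite) (f : ι → M →ₗ[A] N) : g ∘ₗ ∑ᶠ i ∈ s, f i = ∑ᶠ i ∈ s, g ∘ₗ f i :=
  let compHom : (M →ₗ[A] N) →+ (M →ₗ[A] P) :=
    { toFun := fun f => g ∘ₗ f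
      map_zero' := LinearMap.comp_zero g
      map_add' := fun f f' => LinearMap.comp_add f f' g }
  compHom.map_finsum_mem f hs

variable [PartialOrder X] {G : BlockData.{u, v, w} R X} {S : Set (X × X)} {q : X × X} {m : X}

theorem morseMap_eq_add_finsum_flowSet (G : BlockData.{u, v, w} R X) (S : Set (X × X)) (m m' : X) :
    morseMap G S m m' = G.map m m' +
      ∑ᶠ γ ∈ flowSet S m m', pathMap G m' γ.1 γ.2 ∘ₗ G.map m γ.1.2 :=
  rfl

theorem morseMap_of_free (G : BlockData.{u, v, w} R X) (hfree : ∀ r ∈ S, ¬ m ⋖ r.2) (m' : X) :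
    morseMap G S m m' = G.map m m' := by
  rw [morseMap_eq_add_finsum_flowSet, flowSet_of_free hfree, finsum_mem_empty, add_zero]

theorem finsum_pathMap_singleton (hG : ∀ x y, ¬ x ⋖ y → G.map x y = 0) (m' : X) :
    ∑ᶠ γ ∈ {γ : (X × X) × List (X × X) | γ = (q, []) ∧ m ⋖ q.2},
      pathMap G m' γ.1 γ.2 ∘ₗ G.map m γ.1.2 =
      (G.map q.1 m' ∘ₗ (-linInv (G.map q.1 q.2))) ∘ₗ G.map m q.2 := by
  by_cases h : m ⋖ q.2
  · have hset : {γ : (X × X) × List (X × X) | γ = (q, []) ∧ m ⋖ q.2} = {(q, [])} := by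
      ext γ; simp [h]
    rw [hset, finsum_mem_singleton]
    rfl
  · have hset : {γ : (X × X) × List (X × X) | γ = (q, []) ∧ m ⋖ q.2} = ∅ := by
      ext γ; simp [h]
    rw [hset, finsum_mem_empty, hG _ _ h, LinearMap.comp_zero]

theorem finsum_pathMap_flowSetThrough (hG : ∀ x y, ¬ x ⋖ y → G.map x y = 0)
    (hfin : (flowSet S m q.2).Finite) (m' : X) :
    ∑ᶠ γ ∈ flowSetThrough S q m, pathMap G m' γ.1 γ.2 ∘ₗ G.map m γ.1.2 =
      (G.map q.1 m' ∘ₗ (-linInv (G.map q.1 q.2))) ∘ₗ morseMap G S m q.2 := by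
  have hinj : Set.InjOn (fun γ : (X × X) × List (X × X) => (γ.1, γ.2 ++ [q]))
      (flowSet S m q.2) := by
    rintro ⟨p, l⟩ - ⟨p', l'⟩ - h
    simpa using h
  have hdisj : Disjoint {γ : (X × X) × List (X × X) | γ = (q, []) ∧ m ⋖ q.2}
      ((fun γ => (γ.1, γ.2 ++ [q])) '' flowSet S m q.2) := by
    rw [Set.disjoint_left]
    rintro _ ⟨rfl, -⟩ ⟨γ, -, h⟩
    simp at h
  rw [flowSetThrough, finsum_mem_union hdisj ((Set.finite_singleton (q, [])).subset fun _ h => h.1)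
    (hfin.image _), finsum_pathMap_singleton hG, finsum_mem_image hinj,
    morseMap_eq_add_finsum_flowSet, LinearMap.comp_add, comp_finsum_mem _ hfin]
  congr 1
  exact finsum_mem_congr rfl fun γ _ => by rw [pathMap_concat, LinearMap.comp_assoc]

theorem morseMap_insert (hG : ∀ x y, ¬ x ⋖ y → G.map x y = 0) (hq : q ∉ S)
    (hfree : ∀ r ∈ S, ¬ q.1 ⋖ r.2) (hfin : ∀ m', (flowSet S m m').Finite) (m' : X) :
    morseMap G (insert q S) m m' = morseMap G S m m' -
      G.map q.1 m' ∘ₗ linInv (G.map q.1 q.2) ∘ₗ morseMap G S m q.2 := by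
  rw [morseMap_eq_add_finsum_flowSet]
  by_cases hm' : q.1 ⋖ m'
  · rw [flowSet_insert_of_covBy hq hfree hm', finsum_mem_union (disjoint_flowSet_flowSetThrough hq)
      (hfin m') (finite_flowSetThrough (hfin q.2)), finsum_pathMap_flowSetThrough hG (hfin q.2),
      LinearMap.comp_neg, LinearMap.neg_comp, ← sub_eq_add_neg, ← add_sub_assoc]
    rfl
  · rw [flowSet_insert_of_not_covBy hq hfree hm', hG _ _ hm', LinearMap.zero_comp, sub_zero]
    rfl

theorem morseMap_eq_zero (hG : ∀ x y, ¬ x ⋖ y → G.map x y = 0) {m' : X}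
    (hm : ¬ MorseCovers S m m') : morseMap G S m m' = 0 := by
  have hflow : flowSet S m m' = ∅ :=
    Set.eq_empty_of_forall_notMem fun γ h => hm (Or.inr ⟨γ.1, γ.2, h⟩)
  rw [morseMap_eq_add_finsum_flowSet, hflow, finsum_mem_empty, add_zero,
    hG _ _ fun h => hm (Or.inl h)]

end MorseMap

/-! ### Sequences of reductions -/

section Critical

variable {X : Type*} {S : Set (X × X)} {q : X × X} {m : X}

theorem isCritical_insert : IsCritical (insert q S) m ↔ IsCritical S m ∧ m ≠ q.1 ∧ m ≠ q.2 := by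
  obtain ⟨x, y⟩ := q
  simp only [IsCritical, Set.mem_insert_iff, Prod.mk.injEq, not_or]
  constructor
  · refine fun h => ⟨fun z => ⟨(h z).1.2, (h z).2.2⟩, ?_, ?_⟩
    · rintro rfl; exact (h y).1.1 ⟨rfl, rfl⟩
    · rintro rfl; exact (h x).2.1 ⟨rfl, rfl⟩
  · rintro ⟨h, hx, hy⟩ z
    exact ⟨⟨fun e => hx e.1, (h z).1⟩, ⟨fun e => hy e.2, (h z).2⟩⟩

theorem IsCritical.ne_fst (h : IsCritical S m) (hq : q ∈ S) : m ≠ q.1 := by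
  rintro rfl; exact (h q.2).1 hq

theorem IsCritical.ne_snd (h : IsCritical S m) (hq : q ∈ S) : m ≠ q.2 := by
  rintro rfl; exact (h q.1).2 hq

theorem IsCritical.notMem (h : IsCritical S q.1) : q ∉ S :=
  (h q.2).1

end Critical

section Matching

variable {X : Type v} [PartialOrder X] {S : Set (X × X)} {q : X × X}

theorem IsPartialMatching.insert (h : IsPartialMatching S) (hq : q.1 ⋖ q.2)
    (hq₁ : IsCritical S q.1) (hq₂ : IsCritical S q.2) : IsPartialMatching (insert q S) where
  dimension := by
    rintro p (rfl | hp)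
    · exact hq
    · exact h.dimension p hp
  partition := by
    rintro p (rfl | hp) r (rfl | hr) hne
    · exact absurd rfl hne
    · exact ⟨hq₁.ne_fst hr, hq₁.ne_snd hr, hq₂.ne_fst hr, hq₂.ne_snd hr⟩
    · exact ⟨(hq₁.ne_fst hp).symm, (hq₂.ne_fst hp).symm, (hq₁.ne_snd hp).symm,
        (hq₂.ne_snd hp).symm⟩
    · exact h.partition p hp r hr hne

theorem mem_of_transGen_lhd {a b : X × X} (h : Relation.TransGen (Lhd S) a b) : a ∈ S := by
  induction h with
  | single h => exact h.1
  | tail _ _ ih => exact ih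

theorem transGen_lhd_of_insert (hfree : ∀ r ∈ S, ¬ q.1 ⋖ r.2) {a b : X × X}
    (h : Relation.TransGen (Lhd (insert q S)) a b) (hb : b ≠ q) :
    Relation.TransGen (Lhd S) a b := by
  have lhd_of_ne : ∀ {a b : X × X}, Lhd (insert q S) a b → b ≠ q → a ≠ q ∧ Lhd S a b := by
    rintro a b ⟨ha, hb, hab⟩ hne
    have hbS : b ∈ S := hb.resolve_left hne
    have haq : a ≠ q := by
      rintro rfl; exact hfree b hbS hab
    exact ⟨haq, ha.resolve_left haq, hbS, hab⟩
  induction h with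
  | single h => exact .single (lhd_of_ne h hb).2
  | tail _ h ih => exact .tail (ih (lhd_of_ne h hb).1) (lhd_of_ne h hb).2

theorem IsAcyclicMatching.insert (h : IsAcyclicMatching S) (hq : q.1 ⋖ q.2)
    (hq₁ : IsCritical S q.1) (hq₂ : IsCritical S q.2) (hfree : ∀ r ∈ S, ¬ q.1 ⋖ r.2) :
    IsAcyclicMatching (insert q S) where
  toIsPartialMatching := h.toIsPartialMatching.insert hq hq₁ hq₂
  acyclic p r hpr hrp := by
    by_cases hp : p = q <;> by_cases hr : r = q
    · rw [hp, hr]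
    · subst hp
      exact absurd (mem_of_transGen_lhd (transGen_lhd_of_insert hfree hpr hr)) hq₁.notMem
    · subst hr
      exact absurd (mem_of_transGen_lhd (transGen_lhd_of_insert hfree hrp hp)) hq₁.notMem
    · exact h.acyclic p r (transGen_lhd_of_insert hfree hpr hr)
        (transGen_lhd_of_insert hfree hrp hp)

theorem isPartialOrder_morseLE {dim : X → ℕ}
    (hdim : ∀ m m', MorseCovers S m m' → dim m < dim m') :
    IsPartialOrder {m : X // IsCritical S m} (MorseLE S) := by
  have eq_or_lt : ∀ a b : {m : X // IsCritical S m}, MorseLE S a b →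
      a = b ∨ dim a.1 < dim b.1 := by
    intro a b h
    induction h with
    | refl => exact Or.inl rfl
    | tail _ h ih =>
      rcases ih with rfl | ih
      · exact Or.inr (hdim _ _ h)
      · exact Or.inr (ih.trans (hdim _ _ h))
  exact
    { refl := fun _ => Relation.ReflTransGen.refl
      trans := fun _ _ _ => Relation.ReflTransGen.trans
      antisymm := fun a b hab hba => (eq_or_lt a b hab).resolve_right fun hlt =>
        (eq_or_lt b a hba).elim (fun e => by simp [e] at hlt) hlt.asymm }

end Matching

section LinInv

variable {R : Type u} [Ring R] {M N : Type w} [AddCommGroup M] [Module R M] [AddCommGroup N]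
  [Module R N] {f : M →ₗ[R] N}

theorem linInv_comp (hf : Function.Bijective f) : linInv f ∘ₗ f = LinearMap.id := by
  rw [linInv, dif_pos hf]
  exact LinearMap.ext (LinearEquiv.ofBijective f hf).symm_apply_apply

theorem comp_linInv (hf : Function.Bijective f) : f ∘ₗ linInv f = LinearMap.id := by
  rw [linInv, dif_pos hf]
  exact LinearMap.ext (LinearEquiv.ofBijective f hf).apply_symm_apply

end LinInv

/-- A list of pairs, the latest first, that are matched one after the other: each pair is a
covering pair of unmatched elements with invertible block, and its lower element lies below none
of the upper elements matched before. -/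
def IsReductionSeq {R : Type u} [Ring R] {X : Type v} [PartialOrder X]
    (G : BlockData.{u, v, w} R X) : List (X × X) → Prop
  | [] => True
  | q :: L => IsReductionSeq G L ∧ q.1 ⋖ q.2 ∧ Function.Bijective (G.map q.1 q.2) ∧
      IsCritical {r | r ∈ L} q.1 ∧ IsCritical {r | r ∈ L} q.2 ∧ ∀ r ∈ L, ¬ q.1 ⋖ r.2

namespace IsReductionSeq

variable {R : Type u} [Ring R] {X : Type v} [PartialOrder X] {G : BlockData.{u, v, w} R X}
  {L : List (X × X)} {q : X × X}

theorem isAcyclicMatching (h : IsReductionSeq G L) : IsAcyclicMatching {r | r ∈ L} := by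
  induction L with
  | nil =>
    exact
      { dimension := by simp
        partition := by simp
        acyclic := fun p r hpr => by simpa using mem_of_transGen_lhd hpr }
  | cons q L ih =>
    obtain ⟨hL, hq, -, hq₁, hq₂, hfree⟩ := h
    rw [List.setOfPred_mem_cons]
    exact (ih hL).insert hq hq₁ hq₂ hfree

theorem isCompatible (h : IsReductionSeq G L) : IsCompatible G {r | r ∈ L} := by
  induction L with
  | nil => intro p hp; simp at hp
  | cons q L ih =>
    intro p hp
    rcases List.mem_cons.1 hp with rfl | hp
    · exact h.2.2.1
    · exact ih h.1 p hp

theorem nodup_map_fst (h : IsReductionSeq G L) : (L.map Prod.fst).Nodup := by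
  induction L with
  | nil => exact List.nodup_nil
  | cons q L ih =>
    obtain ⟨hL, -, -, hq₁, -, -⟩ := h
    refine List.nodup_cons.2 ⟨fun hmem => ?_, ih hL⟩
    obtain ⟨r, hr, e⟩ := List.mem_map.1 hmem
    exact hq₁.ne_fst hr e.symm

theorem finite_flowSet (h : IsReductionSeq G L) (m m' : X) :
    (flowSet {r | r ∈ L} m m').Finite := by
  induction L generalizing m m' with
  | nil =>
    rw [flowSet_of_free (by simp)]
    exact Set.finite_empty
  | cons q L ih =>
    obtain ⟨hL, -, -, hq₁, -, hfree⟩ := h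
    rw [List.setOfPred_mem_cons]
    exact finite_flowSet_insert hq₁.notMem hfree (ih hL m) m'

theorem morseCovers_cons (h : IsReductionSeq G (q :: L)) {m m' : X} :
    MorseCovers {r | r ∈ q :: L} m m' ↔ MorseCovers {r | r ∈ L} m m' ∨
      (MorseCovers {r | r ∈ L} q.1 m' ∧ MorseCovers {r | r ∈ L} m q.2) := by
  obtain ⟨-, -, -, hq₁, -, hfree⟩ := h
  rw [List.setOfPred_mem_cons, morseCovers_insert hq₁.notMem hfree,
    morseCovers_of_free (S := {r | r ∈ L}) hfree]

theorem dim_of_morseCovers {dim : X → ℕ} (hdim : ∀ x y, x ⋖ y → dim y = dim x + 1)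
    (h : IsReductionSeq G L) {m m' : X} (hm : MorseCovers {r | r ∈ L} m m') :
    dim m' = dim m + 1 := by
  induction L generalizing m m' with
  | nil => exact hdim _ _ ((morseCovers_of_free (by simp)).1 hm)
  | cons q L ih =>
    rcases h.morseCovers_cons.1 hm with hm | ⟨hqm', hmq⟩
    · exact ih h.1 hm
    · rw [ih h.1 hqm', ← ih h.1 hmq, hdim _ _ h.2.1]

theorem bijective_morseMap (h : IsReductionSeq G (q :: L)) :
    Function.Bijective (morseMap G {r | r ∈ L} q.1 q.2) := by
  obtain ⟨-, -, hbij, -, -, hfree⟩ := h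
  rwa [morseMap_of_free (S := {r | r ∈ L}) G hfree]

theorem morseMap_cons (hG : ∀ x y, ¬ x ⋖ y → G.map x y = 0) (h : IsReductionSeq G (q :: L))
    (m m' : X) :
    morseMap G {r | r ∈ q :: L} m m' = morseMap G {r | r ∈ L} m m' -
      morseMap G {r | r ∈ L} q.1 m' ∘ₗ linInv (morseMap G {r | r ∈ L} q.1 q.2) ∘ₗ
        morseMap G {r | r ∈ L} m q.2 := by
  obtain ⟨hL, -, -, hq₁, -, hfree⟩ := h
  rw [List.setOfPred_mem_cons, morseMap_insert hG hq₁.notMem hfree (hL.finite_flowSet m),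
    morseMap_of_free (S := {r | r ∈ L}) G hfree, morseMap_of_free (S := {r | r ∈ L}) G hfree]

theorem morseMap_cons_fst (hG : ∀ x y, ¬ x ⋖ y → G.map x y = 0) (h : IsReductionSeq G (q :: L))
    (m' : X) : morseMap G {r | r ∈ q :: L} q.1 m' = 0 := by
  rw [h.morseMap_cons hG, linInv_comp h.bijective_morseMap, LinearMap.comp_id, sub_self]

theorem morseMap_cons_snd (hG : ∀ x y, ¬ x ⋖ y → G.map x y = 0) (h : IsReductionSeq G (q :: L))
    (m : X) : morseMap G {r | r ∈ q :: L} m q.2 = 0 := by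
  rw [h.morseMap_cons hG, ← LinearMap.comp_assoc, comp_linInv h.bijective_morseMap,
    LinearMap.id_comp, sub_self]

end IsReductionSeq

/-! ### Gaussian elimination in a cochain complex -/

theorem sum_eliminate_comp_eliminate {A X : Type*} [Ring A] {M : X → Type*}
    [∀ x, AddCommGroup (M x)] [∀ x, Module A (M x)] (a : ∀ x y, M x →ₗ[A] M y) {s : Finset X}
    {x y v w : X} (i : M y →ₗ[A] M x) (hwv : ∑ z ∈ s, a z v ∘ₗ a w z = 0)
    (hxv : ∑ z ∈ s, a z v ∘ₗ a x z = 0) (hwy : ∑ z ∈ s, a z y ∘ₗ a w z = 0)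
    (hxy : ∑ z ∈ s, a z y ∘ₗ a x z = 0) :
    ∑ z ∈ s, (a z v - a x v ∘ₗ i ∘ₗ a z y) ∘ₗ (a w z - a x z ∘ₗ i ∘ₗ a w y) = 0 := by
  have apply_sum : ∀ {p q : X}, ∑ z ∈ s, a z q ∘ₗ a p z = 0 → ∀ b, ∑ z ∈ s, a z q (a p z b) = 0 :=
    fun h b => by
      simpa only [LinearMap.sum_apply, LinearMap.comp_apply, LinearMap.zero_apply] using
        LinearMap.congr_fun h b
  ext b
  simp only [LinearMap.sum_apply, LinearMap.comp_apply, LinearMap.sub_apply, map_sub,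
    Finset.sum_sub_distrib, ← map_sum, apply_sum hwv, apply_sum hxv, apply_sum hwy, apply_sum hxy,
    map_zero, sub_self, LinearMap.zero_apply]

namespace BlockData

variable {R : Type u} [Ring R] {Y : Type v} (G : BlockData.{u, v, w} R Y) {dim : Y → ℕ}

theorem coboundary_apply [Fintype Y] {n : ℕ} (f : G.Cochain dim n) (y : {y : Y // dim y = n + 1}) :
    G.coboundary dim n f y = ∑ x : {x : Y // dim x = n}, G.map x.1 y.1 (f x) := by
  rw [coboundary, LinearMap.pi_apply, LinearMap.sum_apply]
  exact Finset.sum_congr (by ext; simp) fun _ _ => rfl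

theorem coboundary_single [Finite Y] [DecidableEq Y] {w : Y} (a : G.obj w)
    (y : {y : Y // dim y = dim w + 1}) :
    G.coboundary dim (dim w) (Pi.single (⟨w, rfl⟩ : {x : Y // dim x = dim w}) a) y =
      G.map w y.1 a := by
  have := Fintype.ofFinite Y
  rw [coboundary_apply, Finset.sum_eq_single (⟨w, rfl⟩ : {x : Y // dim x = dim w}),
    Pi.single_eq_same]
  · intro x _ hx
    rw [Pi.single_eq_of_ne hx, map_zero]
  · simp

variable {G} [Fintype Y]

theorem sum_map_map_eq_sum_comp (hG : ∀ x y, dim y ≠ dim x + 1 → G.map x y = 0) (w v : Y)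
    (a : G.obj w) :
    ∑ z : {z : Y // dim z = dim w + 1}, G.map z.1 v (G.map w z.1 a) =
      (∑ z, G.map z v ∘ₗ G.map w z) a := by
  simp only [LinearMap.sum_apply, LinearMap.comp_apply]
  rw [← Finset.sum_subtype (Finset.univ.filter fun z => dim z = dim w + 1) (by simp)
    (fun z => G.map z v (G.map w z a))]
  refine Finset.sum_subset (Finset.subset_univ _) fun z _ hz => ?_
  rw [hG w z (by simpa using hz), LinearMap.zero_apply, map_zero]

theorem sum_map_comp_map_eq_zero (hG : ∀ x y, dim y ≠ dim x + 1 → G.map x y = 0)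
    (h : G.IsCochainComplex dim) (w v : Y) : ∑ z, G.map z v ∘ₗ G.map w z = 0 := by
  classical
  by_cases hv : dim v = dim w + 1 + 1
  · ext a
    have hsq := congrFun (LinearMap.congr_fun (h (dim w)) (Pi.single ⟨w, rfl⟩ a)) ⟨v, hv⟩
    simp only [LinearMap.comp_apply, coboundary_apply _ (G.coboundary _ _ _),
      coboundary_single] at hsq
    rw [← sum_map_map_eq_sum_comp hG, hsq]
    rfl
  · refine Finset.sum_eq_zero fun z _ => ?_
    by_cases hz : dim z = dim w + 1
    · rw [hG z v (by rwa [hz]), LinearMap.zero_comp]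
    · rw [hG w z hz, LinearMap.comp_zero]

theorem isCochainComplex_of_sum_map_comp_map
    (hG : ∀ x y, dim y ≠ dim x + 1 → G.map x y = 0)
    (h : ∀ w v, ∑ z, G.map z v ∘ₗ G.map w z = 0) : G.IsCochainComplex dim := by
  refine fun n => LinearMap.ext fun f => funext fun v => ?_
  rw [LinearMap.comp_apply, coboundary_apply]
  simp only [coboundary_apply, map_sum]
  rw [Finset.sum_comm]
  refine Finset.sum_eq_zero ?_
  rintro ⟨w, rfl⟩ -
  rw [sum_map_map_eq_sum_comp hG, h, LinearMap.zero_apply]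

end BlockData

namespace IsReductionSeq

variable {R : Type u} [Ring R] {X : Type v} [PartialOrder X] {G : BlockData.{u, v, w} R X}
  {L : List (X × X)}

theorem sum_morseMap_comp_morseMap [Fintype X] (hG : ∀ x y, ¬ x ⋖ y → G.map x y = 0)
    (hsq : ∀ w v, ∑ z, G.map z v ∘ₗ G.map w z = 0) (h : IsReductionSeq G L) {s : Finset X}
    (hs : ∀ z, z ∈ s ↔ IsCritical {r | r ∈ L} z) {w v : X} (hw : w ∈ s) (hv : v ∈ s) :
    ∑ z ∈ s, morseMap G {r | r ∈ L} z v ∘ₗ morseMap G {r | r ∈ L} w z = 0 := by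
  classical
  induction L generalizing s w v with
  | nil =>
    have hs_univ : s = Finset.univ :=
      Finset.eq_univ_of_forall fun z => (hs z).2 (by simp [IsCritical])
    have hmap : ∀ m m', morseMap G {r | r ∈ ([] : List (X × X))} m m' = G.map m m' :=
      fun m m' => morseMap_of_free G (by simp) m'
    simp only [hmap, hs_univ, hsq]
  | cons q L ih =>
    have hs' : ∀ z, z ∈ insert q.1 (insert q.2 s) ↔ IsCritical {r | r ∈ L} z := by
      intro z
      rw [Finset.mem_insert, Finset.mem_insert, hs, List.setOfPred_mem_cons, isCritical_insert]
      obtain ⟨-, -, -, hq₁, hq₂, -⟩ := h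
      by_cases hz₁ : z = q.1
      · simp [hz₁, hq₁]
      · by_cases hz₂ : z = q.2
        · simp [hz₂, hq₂]
        · simp [hz₁, hz₂]
    have hsub : s ⊆ insert q.1 (insert q.2 s) :=
      (Finset.subset_insert _ _).trans (Finset.subset_insert _ _)
    calc
      _ = ∑ z ∈ insert q.1 (insert q.2 s),
            morseMap G {r | r ∈ q :: L} z v ∘ₗ morseMap G {r | r ∈ q :: L} w z := by
        refine Finset.sum_subset hsub fun z hz hzs => ?_
        rcases Finset.mem_insert.1 hz with rfl | hz
        · rw [h.morseMap_cons_fst hG, LinearMap.zero_comp]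
        · obtain rfl := (Finset.mem_insert.1 hz).resolve_right hzs
          rw [h.morseMap_cons_snd hG, LinearMap.comp_zero]
      _ = 0 := by
        have hq₁ : q.1 ∈ insert q.1 (insert q.2 s) := Finset.mem_insert_self _ _
        have hq₂ : q.2 ∈ insert q.1 (insert q.2 s) :=
          Finset.mem_insert_of_mem (Finset.mem_insert_self _ _)
        simp only [h.morseMap_cons hG]
        exact sum_eliminate_comp_eliminate _ _ (ih h.1 hs' (hsub hw) (hsub hv))
          (ih h.1 hs' hq₁ (hsub hv)) (ih h.1 hs' (hsub hw) hq₂) (ih h.1 hs' hq₁ hq₂)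

theorem isCochainComplex_morseData [Finite X] {dim : X → ℕ}
    (hdim : ∀ x y, x ⋖ y → dim y = dim x + 1)
    (hG : ∀ x y, ¬ x ⋖ y → G.map x y = 0) (hc : G.IsCochainComplex dim)
    (h : IsReductionSeq G L) : (morseData G {r | r ∈ L}).IsCochainComplex (fun m => dim m.1) := by
  classical
  have := Fintype.ofFinite X
  have hsq := BlockData.sum_map_comp_map_eq_zero
    (fun x y hxy => hG x y fun hcov => hxy (hdim x y hcov)) hc
  refine BlockData.isCochainComplex_of_sum_map_comp_map (fun m m' hm => ?_) fun m m' => ?_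
  · exact morseMap_eq_zero hG fun hcov => hm (h.dim_of_morseCovers hdim hcov)
  · have hs : ∀ z, z ∈ Finset.univ.filter (IsCritical {r | r ∈ L}) ↔ IsCritical {r | r ∈ L} z := by
      simp
    have hsum := h.sum_morseMap_comp_morseMap hG hsq hs ((hs _).2 m.2) ((hs _).2 m'.2)
    rwa [Finset.sum_subtype _ hs
      (fun z => morseMap G {r | r ∈ L} z m'.1 ∘ₗ morseMap G {r | r ∈ L} m.1 z)] at hsum

end IsReductionSeq

/-! ### Matrix arithmetic -/

section Matrices

variable {R : Type u}

theorem rowMajor_lt {a b : ℕ} (i : Fin a) (j : Fin b) : (i : ℕ) * b + j < a * b :=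
  calc (i : ℕ) * b + j < i * b + b := by omega
    _ = (i + 1) * b := by ring
    _ ≤ a * b := Nat.mul_le_mul_right _ i.2

theorem divNat_rowMajor {a b : ℕ} (i : Fin a) (j : Fin b) :
    Fin.divNat ⟨i * b + j, rowMajor_lt i j⟩ = i :=
  Fin.ext (by simp [Fin.divNat, Nat.add_div_of_dvd_right, Nat.mul_div_cancel _ j.pos,
    Nat.div_eq_of_lt j.2])

theorem modNat_rowMajor {a b : ℕ} (i : Fin a) (j : Fin b) :
    Fin.modNat ⟨i * b + j, rowMajor_lt i j⟩ = j :=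
  Fin.ext (by simp [Fin.modNat, Nat.mod_eq_of_lt j.2])

theorem entries_eq_ofFn {a b : ℕ} (A : Matrix (Fin a) (Fin b) R) :
    entries A = List.ofFn fun k : Fin (a * b) => A k.divNat k.modNat := by
  rw [entries, List.ofFn_mul]
  simp only [divNat_rowMajor, modNat_rowMajor]

theorem length_entries {a b : ℕ} (A : Matrix (Fin a) (Fin b) R) :
    (entries A).length = a * b := by
  rw [entries_eq_ofFn, List.length_ofFn]

theorem getD_entries [Zero R] {a b : ℕ} (A : Matrix (Fin a) (Fin b) R) (i : Fin a) (j : Fin b) :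
    (entries A).getD (i * b + j) 0 = A i j := by
  rw [List.getD_eq_getElem _ _ (by simpa only [length_entries] using rowMajor_lt i j)]
  simp only [entries_eq_ofFn, List.getElem_ofFn, divNat_rowMajor, modNat_rowMajor]

theorem ofEntries_entries [Zero R] {a b : ℕ} (A : Matrix (Fin a) (Fin b) R) :
    ofEntries a b b (entries A) = A := by
  ext i j
  exact getD_entries A i j

theorem pad_castLE [Zero R] {a b e : ℕ} (A : Matrix (Fin a) (Fin b) R) (ha : a ≤ e) (hb : b ≤ e)
    (i : Fin a) (j : Fin b) : pad e A (Fin.castLE ha i) (Fin.castLE hb j) = A i j := by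
  simp [pad]

theorem pad_mul_pad_castLE [Ring R] {a b c e : ℕ} (A : Matrix (Fin a) (Fin b) R)
    (B : Matrix (Fin b) (Fin c) R) (ha : a ≤ e) (hb : b ≤ e) (hc : c ≤ e)
    (i : Fin a) (j : Fin c) :
    (pad e A * pad e B) (Fin.castLE ha i) (Fin.castLE hc j) = (A * B) i j := by
  have hterm (k : Fin b) : A i k * B k j =
      pad e A (Fin.castLE ha i) (Fin.castLEEmb hb k) *
        pad e B (Fin.castLEEmb hb k) (Fin.castLE hc j) := by
    rw [Fin.castLEEmb_apply, pad_castLE, pad_castLE]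
  simp only [Matrix.mul_apply, hterm]
  rw [← Finset.sum_map Finset.univ (Fin.castLEEmb hb) fun k =>
    pad e A (Fin.castLE ha i) k * pad e B k (Fin.castLE hc j)]
  refine (Finset.sum_subset (Finset.subset_univ _) fun k _ hk => ?_).symm
  have hbk : ¬ (k : ℕ) < b := fun hlt =>
    hk (Finset.mem_map.2 ⟨⟨k, hlt⟩, Finset.mem_univ _, rfl⟩)
  simp [pad, hbk]

variable [Ring R]

theorem Prog.length_lt_cost {s : ℕ} {P : Prog R s} {m : Fin s → R} {out : List R}
    (h : P.eval m = some out) : out.length < P.cost := by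
  induction P generalizing m with
  | ret o =>
    simp only [Prog.eval, Option.some.injEq] at h
    simp [Prog.cost, ← h]
  | fail => simp [Prog.eval] at h
  | const _ _ _ ih | add _ _ _ _ ih | sub _ _ _ _ ih | mul _ _ _ _ ih =>
    exact (ih h).trans (Nat.lt_succ_self _)
  | inv _ _ _ _ ih ih' | ifZero _ _ _ ih ih' =>
    simp only [Prog.eval] at h
    simp only [Prog.cost]
    split_ifs at h
    · have := ih h; omega
    · have := ih' h; omega

namespace MatrixKit

variable (kit : MatrixKit R)

theorem mulRect_eq_mul {a b c : ℕ} (A : Matrix (Fin a) (Fin b) R)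
    (B : Matrix (Fin b) (Fin c) R) : kit.mulRect A B = A * B := by
  have ha : a ≤ mulSize a b c := le_max_left _ _
  have hb : b ≤ mulSize a b c := (le_max_left _ _).trans (le_max_right _ _)
  have hc : c ≤ mulSize a b c := (le_max_right _ _).trans (le_max_right _ _)
  ext i j
  rw [← pad_mul_pad_castLE A B ha hb hc, mulRect]
  simp only [kit.mul_run, Option.getD_some]
  exact getD_entries _ (Fin.castLE ha i) (Fin.castLE hc j)

theorem mul_eq_one_of_invRect_eq_some {a b : ℕ} {A : Matrix (Fin a) (Fin b) R}
    {B : Matrix (Fin b) (Fin a) R} (h : kit.invRect A = some B) : A * B = 1 ∧ B * A = 1 := by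
  by_cases hA : ∃ B : Matrix (Fin b) (Fin a) R, A * B = 1 ∧ B * A = 1
  · obtain ⟨B', h1, h2⟩ := hA
    rw [invRect, kit.inv_run_some a b A B' h1 h2, Option.map_some, ofEntries_entries] at h
    rw [← Option.some.inj h]
    exact ⟨h1, h2⟩
  · simp [invRect, kit.inv_run_none a b A hA] at h

theorem sq_lt_cost_mul (e : ℕ) : e ^ 2 < (kit.mul e).cost := by
  have := Prog.length_lt_cost (kit.mul_run e 0 0)
  rwa [length_entries, ← sq] at this

/-- A bound for the running time of one multiplication or inversion of matrices of size at
most `d`, including the time for loading, copying and subtracting such matrices. -/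
def opTime (d : ℕ) : ℕ :=
  (Finset.range (d + 1)).sup (fun e => (kit.mul e).cost) +
  (Finset.range (d + 1) ×ˢ Finset.range (d + 1)).sup (fun ab => (kit.inv ab.1 ab.2).cost) +
  3 * (d + 1) ^ 2

/-- A bound for the number of registers used by one multiplication or inversion of matrices of
size at most `d`. -/
def opRegs (d : ℕ) : ℕ :=
  max ((Finset.range (d + 1)).sup kit.mulRegs)
    ((Finset.range (d + 1) ×ˢ Finset.range (d + 1)).sup fun ab => kit.invRegs ab.1 ab.2)

variable {a b c d : ℕ}

theorem mulSize_le (ha : a ≤ d) (hb : b ≤ d) (hc : c ≤ d) : mulSize a b c ≤ d :=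
  max_le ha (max_le hb hc)

theorem mulTime_le_opTime (ha : a ≤ d) (hb : b ≤ d) (hc : c ≤ d) :
    kit.mulTime a b c ≤ kit.opTime d := by
  have he := mulSize_le ha hb hc
  have hsq : mulSize a b c ^ 2 ≤ (d + 1) ^ 2 := by gcongr; omega
  have hac : a * c ≤ (d + 1) ^ 2 := by rw [sq]; gcongr <;> omega
  have hcost : (kit.mul (mulSize a b c)).cost ≤ _ := Finset.le_sup
    (f := fun e => (kit.mul e).cost) (Finset.mem_range.2 (Nat.lt_add_one_of_le he))
  rw [mulTime, opTime]
  omega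

theorem invTime_le_opTime (ha : a ≤ d) (hb : b ≤ d) : kit.invTime a b ≤ kit.opTime d := by
  have hab : a * b ≤ (d + 1) ^ 2 := by rw [sq]; gcongr <;> omega
  have hcost : (kit.inv a b).cost ≤ _ := Finset.le_sup
    (f := fun ab : ℕ × ℕ => (kit.inv ab.1 ab.2).cost)
    (Finset.mk_mem_product (Finset.mem_range.2 (Nat.lt_add_one_of_le ha))
      (Finset.mem_range.2 (Nat.lt_add_one_of_le hb)))
  rw [invTime, opTime, mul_comm b a]
  omega

theorem mul_add_two_le_opTime (ha : a ≤ d) (hb : b ≤ d) : a * b + 2 ≤ kit.opTime d := by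
  have hab : a * b ≤ (d + 1) ^ 2 := by rw [sq]; gcongr <;> omega
  have hd : 1 ≤ (d + 1) ^ 2 := Nat.one_le_pow _ _ d.succ_pos
  rw [opTime]
  omega

theorem one_le_opTime (d : ℕ) : 1 ≤ kit.opTime d :=
  le_trans (by omega) (kit.mul_add_two_le_opTime d.zero_le d.zero_le)

theorem mulRegs_le_opRegs (ha : a ≤ d) : kit.mulRegs a ≤ kit.opRegs d :=
  (Finset.le_sup (f := kit.mulRegs) (Finset.mem_range_succ_iff.2 ha)).trans (le_max_left _ _)

theorem invRegs_le_opRegs (ha : a ≤ d) (hb : b ≤ d) : kit.invRegs a b ≤ kit.opRegs d :=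
  (Finset.le_sup (f := fun ab : ℕ × ℕ => kit.invRegs ab.1 ab.2)
    (Finset.mk_mem_product (Finset.mem_range_succ_iff.2 ha)
      (Finset.mem_range_succ_iff.2 hb))).trans (le_max_right _ _)

variable {kit} {ω : ℝ}

/-- The output of a product has `e²` entries, so its computation takes more than `e²` steps. -/
theorem HasExponent.nonneg (h : kit.HasExponent ω) : 0 ≤ ω := by
  by_contra! hω
  obtain ⟨K, hK⟩ := h
  obtain ⟨e, he⟩ := exists_nat_gt (max K 1)
  obtain ⟨heK, he1⟩ := max_lt_iff.1 he
  have hcost := (hK e (by exact_mod_cast he1.le)).1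
  have hsq : (e : ℝ) ^ 2 < (kit.mul e).cost := by exact_mod_cast kit.sq_lt_cost_mul e
  have hpow : (e : ℝ) ^ ω ≤ 1 := Real.rpow_le_one_of_one_le_of_nonpos he1.le hω.le
  have hpow0 : (0 : ℝ) ≤ (e : ℝ) ^ ω := by positivity
  nlinarith

theorem HasExponent.exists_cost_le (h : kit.HasExponent ω) :
    ∃ K : ℝ, 0 ≤ K ∧ ∀ d : ℕ, 1 ≤ d →
      (∀ e ≤ d, ((kit.mul e).cost : ℝ) ≤ K * (d : ℝ) ^ ω) ∧
      ∀ a ≤ d, ∀ b ≤ d, ((kit.inv a b).cost : ℝ) ≤ K * (d : ℝ) ^ ω := by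
  have hω := h.nonneg
  obtain ⟨K, hK⟩ := h
  have hK0 : 0 ≤ K := by
    have h1 := (hK 1 le_rfl).1
    rw [Nat.cast_one, Real.one_rpow, mul_one] at h1
    exact (Nat.cast_nonneg _).trans h1
  refine ⟨(kit.mul 0).cost + K, by positivity, fun d hd => ⟨fun e he => ?_, fun a ha b hb => ?_⟩⟩
  · have hd1 : (1 : ℝ) ≤ (d : ℝ) ^ ω := Real.one_le_rpow (by exact_mod_cast hd) hω
    rcases Nat.eq_zero_or_pos e with rfl | hpos
    · nlinarith [Nat.cast_nonneg (α := ℝ) (kit.mul 0).cost]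
    · calc ((kit.mul e).cost : ℝ) ≤ K * (e : ℝ) ^ ω := (hK e hpos).1
        _ ≤ ((kit.mul 0).cost + K) * (d : ℝ) ^ ω := by
          gcongr
          exact le_add_of_nonneg_left (Nat.cast_nonneg _)
  · calc ((kit.inv a b).cost : ℝ) ≤ K * (d : ℝ) ^ ω := (hK d hd).2 a b ha hb
      _ ≤ ((kit.mul 0).cost + K) * (d : ℝ) ^ ω := by
        gcongr
        exact le_add_of_nonneg_left (Nat.cast_nonneg _)

theorem HasExponent.exists_opTime_le (h : kit.HasExponent ω) :
    ∃ C : ℝ, 0 ≤ C ∧ ∀ d : ℕ, 1 ≤ d → (kit.opTime d : ℝ) ≤ C * (d : ℝ) ^ ω := by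
  obtain ⟨K, hK0, hK⟩ := h.exists_cost_le
  refine ⟨14 * K, by positivity, fun d hd => ?_⟩
  obtain ⟨hmul, hinv⟩ := hK d hd
  obtain ⟨e, he, hmul_eq⟩ := Finset.exists_mem_eq_sup (Finset.range (d + 1)) (by simp)
    fun e => (kit.mul e).cost
  obtain ⟨ab, hab, hinv_eq⟩ := Finset.exists_mem_eq_sup
    (Finset.range (d + 1) ×ˢ Finset.range (d + 1)) (by simp)
    fun ab => (kit.inv ab.1 ab.2).cost
  rw [Finset.mem_product, Finset.mem_range_succ_iff, Finset.mem_range_succ_iff] at hab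
  have hmul_le := hmul e (Finset.mem_range_succ_iff.1 he)
  have hinv_le := hinv ab.1 hab.1 ab.2 hab.2
  have hsq : 3 * ((d : ℝ) + 1) ^ 2 ≤ 12 * (kit.mul d).cost := by
    have hd1 : (1 : ℝ) ≤ d := by exact_mod_cast hd
    have hlt : (d : ℝ) ^ 2 < (kit.mul d).cost := by exact_mod_cast kit.sq_lt_cost_mul d
    nlinarith
  rw [opTime, hmul_eq, hinv_eq]
  push_cast
  linarith [hmul d le_rfl]

theorem HasWorkspace.opRegs_le {W : ℕ} (h : kit.HasWorkspace W) (hd : 1 ≤ d) :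
    kit.opRegs d ≤ kit.mulRegs 0 + W * d ^ 2 := by
  refine max_le (Finset.sup_le fun e he => ?_) (Finset.sup_le fun ab hab => ?_)
  · rcases Nat.eq_zero_or_pos e with rfl | hpos
    · exact Nat.le_add_right _ _
    · have hed := Finset.mem_range_succ_iff.1 he
      exact ((h e hpos).1.trans (by gcongr)).trans (Nat.le_add_left _ _)
  · rw [Finset.mem_product, Finset.mem_range_succ_iff, Finset.mem_range_succ_iff] at hab
    exact ((h d hd).2 ab.1 ab.2 hab.1 hab.2).trans (Nat.le_add_left _ _)

end MatrixKit

end Matrices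

namespace Input

variable {R : Type u} [Ring R] {X : Type v} [PartialOrder X] [Fintype X]
  (I : Input.{u, v, w} R X)

section MatrixOf

variable {x y z : X}

theorem matrixOf_comp (g : I.F.obj y →ₗ[R] I.F.obj z) (f : I.F.obj x →ₗ[R] I.F.obj y) :
    I.matrixOf (g ∘ₗ f) = I.matrixOf f * I.matrixOf g := by
  ext i j
  have h : f (I.basis x i) = ∑ k, I.matrixOf f i k • I.basis y k :=
    ((I.basis y).sum_repr (f (I.basis x i))).symm
  rw [Matrix.mul_apply]
  change (I.basis z).repr (g (f (I.basis x i))) j = _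
  rw [h, map_sum, map_sum, Finsupp.finsetSum_apply]
  refine Finset.sum_congr rfl fun k _ => ?_
  rw [map_smul, map_smul]
  rfl

theorem matrixOf_sub (f g : I.F.obj x →ₗ[R] I.F.obj y) :
    I.matrixOf (f - g) = I.matrixOf f - I.matrixOf g := by
  ext i j
  simp [matrixOf]

theorem matrixOf_zero : I.matrixOf (0 : I.F.obj x →ₗ[R] I.F.obj y) = 0 := by
  ext i j
  simp [matrixOf]

theorem matrixOf_id : I.matrixOf (LinearMap.id : I.F.obj x →ₗ[R] I.F.obj x) = 1 := by
  ext i j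
  simp [matrixOf, Finsupp.single_apply, Matrix.one_apply]

theorem matrixOf_injective :
    Function.Injective (I.matrixOf : (I.F.obj x →ₗ[R] I.F.obj y) → _) := by
  intro f g h
  refine (I.basis x).ext fun i => (I.basis y).repr.injective (Finsupp.ext fun j => ?_)
  exact congrFun (congrFun h i) j

theorem matrixOf_surjective :
    Function.Surjective (I.matrixOf : (I.F.obj x →ₗ[R] I.F.obj y) → _) := by
  intro A
  refine ⟨(I.basis x).constr ℕ fun i => ∑ j, A i j • I.basis y j, ?_⟩
  ext i j
  simp [matrixOf, Finsupp.single_apply]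

variable {I} {f : I.F.obj x →ₗ[R] I.F.obj y} {B : Matrix (Fin (I.rank y)) (Fin (I.rank x)) R}

theorem exists_inverse_of_matrixOf_mul_eq_one (h1 : I.matrixOf f * B = 1)
    (h2 : B * I.matrixOf f = 1) :
    ∃ g : I.F.obj y →ₗ[R] I.F.obj x,
      I.matrixOf g = B ∧ g ∘ₗ f = LinearMap.id ∧ f ∘ₗ g = LinearMap.id := by
  obtain ⟨g, rfl⟩ := I.matrixOf_surjective B
  exact ⟨g, rfl, I.matrixOf_injective (by rw [matrixOf_comp, matrixOf_id, h1]),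
    I.matrixOf_injective (by rw [matrixOf_comp, matrixOf_id, h2])⟩

theorem bijective_of_matrixOf_mul_eq_one (h1 : I.matrixOf f * B = 1)
    (h2 : B * I.matrixOf f = 1) : Function.Bijective f := by
  obtain ⟨g, -, hgf, hfg⟩ := exists_inverse_of_matrixOf_mul_eq_one h1 h2
  exact Function.bijective_iff_has_inverse.2
    ⟨g, fun a => LinearMap.congr_fun hgf a, fun a => LinearMap.congr_fun hfg a⟩

theorem matrixOf_linInv (h1 : I.matrixOf f * B = 1) (h2 : B * I.matrixOf f = 1) :
    I.matrixOf (linInv f) = B := by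
  obtain ⟨g, rfl, -, hfg⟩ := exists_inverse_of_matrixOf_mul_eq_one h1 h2
  congr 1
  calc linInv f = linInv f ∘ₗ (f ∘ₗ g) := by rw [hfg, LinearMap.comp_id]
    _ = g := by
      rw [← LinearMap.comp_assoc, linInv_comp (bijective_of_matrixOf_mul_eq_one h1 h2),
        LinearMap.id_comp]

end MatrixOf

theorem rank_le_maxRank (x : X) : I.rank x ≤ I.maxRank := Finset.le_sup (Finset.mem_univ x)

theorem length_elems : I.elems.length = Fintype.card X := by
  classical
  rw [← List.toFinset_card_of_nodup I.nodup_elems,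
    Finset.eq_univ_of_forall fun x => List.mem_toFinset.2 (I.mem_elems x), Finset.card_univ]

theorem length_up_le (x : X) : (I.up x).length ≤ maxCovers X := by
  classical
  calc (I.up x).length = Set.ncard {y : X | x ⋖ y} := by
        rw [← List.toFinset_card_of_nodup (I.nodup_up x), ← Set.ncard_coe_finset]
        congr 1
        ext y
        simp [I.mem_up]
    _ ≤ maxCovers X :=
        Finset.le_sup (f := fun x : X => Set.ncard {y : X | x ⋖ y}) (Finset.mem_univ x)

theorem sum_length_down_eq_sum_length_up : ∑ y, (I.down y).length = ∑ x, (I.up x).length := by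
  classical
  have hdown (y : X) : (I.down y).length = (Finset.univ.bipartiteBelow (· ⋖ ·) y).card := by
    rw [← List.toFinset_card_of_nodup (I.nodup_down y)]
    congr 1
    ext x
    simp [I.mem_down]
  have hup (x : X) : (I.up x).length = (Finset.univ.bipartiteAbove (· ⋖ ·) x).card := by
    rw [← List.toFinset_card_of_nodup (I.nodup_up x)]
    congr 1
    ext y
    simp [I.mem_up]
  simp only [hdown, hup]
  exact (Finset.sum_card_bipartiteAbove_eq_sum_card_bipartiteBelow _).symm

theorem sum_length_down_le : ∑ y, (I.down y).length ≤ Fintype.card X * maxCovers X := by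
  rw [sum_length_down_eq_sum_length_up]
  exact (Finset.sum_le_card_nsmul _ _ _ fun x _ => I.length_up_le x).trans (by simp)

end Input

namespace Store

/-! ### Bookkeeping of the store -/

section Counters

variable {R : Type u} {X : Type v} {rank : X → ℕ} [Fintype X] [DecidableEq X]

theorem decr_eq (l : List X) (s : Store R X rank) :
    decr l s = { s with
      cnt := fun z => s.cnt z - l.count z
      time := s.time + l.length
      mem := (decr l s).mem } := by
  induction l generalizing s with
  | nil => rfl
  | cons a l ih =>
    refine (ih (({ s with cnt := Function.update s.cnt a (s.cnt a - 1) }).charge 1 0)).trans ?_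
    simp only [charge, decr, List.foldl_cons, List.length_cons, add_assoc, add_comm 1]
    congr 1
    funext z
    obtain rfl | hz := eq_or_ne z a
    · rw [Function.update_self, List.count_cons_self]
      omega
    · rw [Function.update_of_ne hz, List.count_cons_of_ne hz.symm]

theorem mark_eq (c : X) (s : Store R X rank) :
    mark c s = { s with
      crit := Function.update s.crit c true
      cnt := fun z => s.cnt z - (s.up c).count z
      time := s.time + 1 + (s.up c).length
      mem := (mark c s).mem } :=
  decr_eq _ _

theorem remove_eq (x : X) (s : Store R X rank) :
    remove x s = { s with
      alive := Function.update s.alive x false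
      cnt := fun z => s.cnt z - (s.up x).count z
      time := s.time + 1 + (s.up x).length
      mem := (remove x s).mem } :=
  decr_eq _ _

end Counters

section Queue

variable {R : Type u} {X : Type v} {rank : X → ℕ}

/-- The part of the store on which the meaning of the stored data depends: the queue, its flags
and the cost counters are reset. -/
def core (s : Store R X rank) : Store R X rank :=
  { s with queue := [], queued := fun _ => false, time := 0, mem := 0, work := 0 }

/-- The elements that are in the queue or may still enter it. -/
def Pending (s : Store R X rank) (z : X) : Prop := z ∈ s.queue ∨ s.queued z = false

/-- The queue lists present non-critical elements of dimension `k + 1` without repetition, all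
of them flagged. -/
structure QueueOK (dim : X → ℕ) (k : ℕ) (s : Store R X rank) : Prop where
  nodup : s.queue.Nodup
  queued : ∀ z ∈ s.queue, s.queued z = true
  alive : ∀ z ∈ s.queue, s.alive z = true
  crit : ∀ z ∈ s.queue, s.crit z = false
  dim : ∀ z ∈ s.queue, dim z = k + 1

variable {s : Store R X rank} {dim : X → ℕ} {k : ℕ} {z : X}

theorem QueueOK.notMem_of_queued_eq_false (h : s.QueueOK dim k) (hz : s.queued z = false) :
    z ∉ s.queue := fun hmem => by
  simp [h.queued z hmem] at hz

variable [Fintype X]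

theorem QueueOK.charge (h : s.QueueOK dim k) (t extra : ℕ) :
    (s.charge t extra).QueueOK dim k :=
  ⟨h.nodup, h.queued, h.alive, h.crit, h.dim⟩

variable [DecidableEq X]

/-- Append `z` to the queue and flag it. -/
def push (z : X) (s : Store R X rank) : Store R X rank :=
  ({ s with queue := s.queue ++ [z], queued := Function.update s.queued z true }).charge 1 0

theorem enqueue_induction {P : Store R X rank → Prop} (l : List X) (hs : P s)
    (hskip : ∀ s, P s → P (s.charge 1 0))
    (hpush : ∀ s z, P s → s.alive z = true → s.crit z = false → s.queued z = false →
      dim z = k + 1 → P (s.push z)) :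
    P (enqueue dim k l s) := by
  refine List.foldlRecOn _ _ hs fun s hs z _ => ?_
  split_ifs with hz
  · simp only [Bool.and_eq_true, Bool.not_eq_true', decide_eq_true_eq] at hz
    exact hpush s z hs hz.1.1.1 hz.1.1.2 hz.1.2 hz.2
  · exact hskip s hs

theorem core_enqueue (l : List X) : (enqueue dim k l s).core = s.core :=
  enqueue_induction (P := fun s' => s'.core = s.core) l rfl (fun _ h => h) fun _ _ h _ _ _ _ => h

theorem time_enqueue (l : List X) : (enqueue dim k l s).time = s.time + l.length := by
  induction l generalizing s with
  | nil => rfl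
  | cons a l ih =>
    rw [List.length_cons, add_comm l.length, ← add_assoc]
    refine ih.trans (congrArg (· + l.length) ?_)
    dsimp only
    split_ifs <;> rfl

theorem pending_enqueue (l : List X) : (enqueue dim k l s).Pending = s.Pending :=
  enqueue_induction (P := fun s' => s'.Pending = s.Pending) l rfl (fun _ h => h)
    fun s' a h _ _ ha _ => by
      rw [← h]
      ext z
      obtain rfl | hz := eq_or_ne z a
      · simp [Pending, push, charge, ha]
      · simp [Pending, push, charge, hz]

theorem QueueOK.push (h : s.QueueOK dim k) (ha : s.alive z = true) (hc : s.crit z = false)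
    (hz : s.queued z = false) (hd : dim z = k + 1) : (s.push z).QueueOK dim k := by
  have hforall {P : X → Prop} (hq : ∀ w ∈ s.queue, P w) (hz : P z) : ∀ w ∈ s.queue ++ [z], P w :=
    List.forall_mem_append.2 ⟨hq, List.forall_mem_singleton.2 hz⟩
  have hnotMem := h.notMem_of_queued_eq_false hz
  have hnodup : (s.queue ++ [z]).Nodup := by
    rw [← List.concat_eq_append]
    exact h.nodup.concat hnotMem
  refine ⟨hnodup, hforall (fun w hw => ?_) (Function.update_self ..), hforall h.alive ha,
    hforall h.crit hc, hforall h.dim hd⟩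
  exact (Function.update_of_ne (ne_of_mem_of_not_mem hw hnotMem) ..).trans (h.queued w hw)

theorem QueueOK.enqueue (h : s.QueueOK dim k) (l : List X) :
    (enqueue dim k l s).QueueOK dim k :=
  enqueue_induction l h (fun _ h => h.charge 1 0) fun _ _ h => h.push

end Queue

/-! ### Space bounds -/

section Sound

/-- The unit in which memory is measured. -/
def cells (X : Type v) [Fintype X] (d : ℕ) : ℕ := (Fintype.card X + 1) ^ 2 * (d + 1) ^ 2

section Cells

variable {X : Type v} [Fintype X] {d : ℕ}

theorem card_le_cells : Fintype.card X ≤ cells X d := by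
  have hd : 1 ≤ (d + 1) ^ 2 := Nat.one_le_pow _ _ d.succ_pos
  rw [cells]
  nlinarith

theorem mul_le_cells {a b : ℕ} (ha : a ≤ d) (hb : b ≤ d) : a * b ≤ cells X d := by
  have hX : 1 ≤ (Fintype.card X + 1) ^ 2 := Nat.one_le_pow _ _ (Fintype.card X).succ_pos
  calc a * b ≤ (d + 1) ^ 2 := by rw [sq]; gcongr <;> omega
    _ ≤ cells X d := Nat.le_mul_of_pos_left _ hX

end Cells

variable {R : Type u} {X : Type v} {rank : X → ℕ} [Fintype X]

theorem sum_entries_le {s : Store R X rank} (hd : ∀ x, rank x ≤ d) :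
    ∑ x, ∑ y, (1 + if (s.blk x y).isSome then rank x * rank y else 0) ≤
      Fintype.card X * (Fintype.card X * (1 + d * d)) := by
  refine Finset.sum_le_card_nsmul _ _ _ fun x _ => Finset.sum_le_card_nsmul _ _ _ fun y _ => ?_
  have := Nat.mul_le_mul (hd x) (hd y)
  split_ifs <;> omega

variable [Ring R]

/-- The adjacency lists and the table of matrices describe the same relation, no list has
repetitions, and the space used so far is within its bounds. -/
structure Sound (kit : MatrixKit R) (d : ℕ) (s : Store R X rank) : Prop where
  nodup_up : ∀ w, (s.up w).Nodup
  nodup_down : ∀ z, (s.down z).Nodup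
  mem_up : ∀ w z, z ∈ s.up w ↔ (s.blk w z).isSome = true
  mem_down : ∀ w z, w ∈ s.down z ↔ (s.blk w z).isSome = true
  nodup_queue : s.queue.Nodup
  length_pairs : s.pairs.length ≤ Fintype.card X
  mem_le : s.mem ≤ 48 * cells X d
  work_le : s.work ≤ kit.opRegs d

variable {kit : MatrixKit R} {d : ℕ} {s : Store R X rank}

theorem Sound.size_le (h : s.Sound kit d) (hd : ∀ x, rank x ≤ d) : s.size ≤ 32 * cells X d := by
  have hlists : ∑ x, (11 + 2 * (s.up x).length + 2 * (s.down x).length) ≤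
      Fintype.card X * (11 + 4 * Fintype.card X) := by
    refine Finset.sum_le_card_nsmul _ _ _ fun x _ => ?_
    have hup := (h.nodup_up x).length_le_card
    have hdown := (h.nodup_down x).length_le_card
    omega
  have hentries := sum_entries_le (s := s) hd
  have hqueue := h.nodup_queue.length_le_card
  have hpairs := h.length_pairs
  rw [size, cells]
  generalize Fintype.card X = n at *
  have : 0 ≤ n * d := Nat.zero_le _
  have : 0 ≤ n * n * d := Nat.zero_le _
  have : 0 ≤ n * d * d := Nat.zero_le _
  nlinarith

theorem Sound.charge (h : s.Sound kit d) (hd : ∀ x, rank x ≤ d) (t : ℕ) {extra : ℕ}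
    (he : extra ≤ 16 * cells X d) : (s.charge t extra).Sound kit d where
  __ := h
  mem_le := max_le h.mem_le (by have := h.size_le hd; omega)

theorem Sound.useWork (h : s.Sound kit d) {r : ℕ} (hr : r ≤ kit.opRegs d) :
    (s.useWork r).Sound kit d where
  __ := h
  work_le := max_le h.work_le hr

theorem Sound.setQueue (h : s.Sound kit d) {q : List X} (hq : q.Nodup) (f : X → Bool) :
    ({ s with queue := q, queued := f }).Sound kit d where
  __ := h
  nodup_queue := hq

theorem Sound.setFlags (h : s.Sound kit d) (a c : X → Bool) (n : X → ℕ) :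
    ({ s with alive := a, crit := c, cnt := n }).Sound kit d where
  __ := h

variable [DecidableEq X]

theorem Sound.enqueue (h : s.Sound kit d) (hd : ∀ x, rank x ≤ d) {dim : X → ℕ} {k : ℕ}
    (hq : s.QueueOK dim k) (l : List X) : (enqueue dim k l s).Sound kit d := by
  refine (enqueue_induction (P := fun s => s.Sound kit d ∧ s.QueueOK dim k) l ⟨h, hq⟩
    (fun s h => ⟨h.1.charge hd 1 (Nat.zero_le _), h.2.charge 1 0⟩)
    fun s z h ha hc hz hdim => ?_).1
  have hpush := h.2.push ha hc hz hdim
  exact ⟨(h.1.setQueue hpush.nodup _).charge hd 1 (Nat.zero_le _), hpush⟩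

theorem Sound.decr (h : s.Sound kit d) (hd : ∀ x, rank x ≤ d) (l : List X) :
    (decr l s).Sound kit d :=
  List.foldlRecOn _ _ h fun s h _ _ => (h.setFlags s.alive s.crit _).charge hd 1 (Nat.zero_le _)

theorem Sound.mark (h : s.Sound kit d) (hd : ∀ x, rank x ≤ d) (c : X) :
    (mark c s).Sound kit d :=
  ((h.setFlags s.alive _ s.cnt).charge hd 1 (Nat.zero_le _)).decr hd _

theorem Sound.remove (h : s.Sound kit d) (hd : ∀ x, rank x ≤ d) (x : X) :
    (remove x s).Sound kit d :=
  ((h.setFlags _ s.crit s.cnt).charge hd 1 (Nat.zero_le _)).decr hd _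

end Sound

end Store

namespace Store

/-! ### Updating the matrices -/

section Cover

variable {R : Type u} {X : Type v} {rank : X → ℕ} [DecidableEq X] {s : Store R X rank}
  {w z w' z' : X}

theorem setCover_eq (w z : X) (s : Store R X rank) :
    setCover w z s =
      { s with up := (setCover w z s).up, down := (setCover w z s).down } := by
  rw [setCover]
  split_ifs <;> rfl

theorem up_setCover_of_ne (h : w' ≠ w) : (setCover w z s).up w' = s.up w' := by
  rw [setCover]
  split_ifs
  · rfl
  · exact Function.update_of_ne h ..

theorem down_setCover_of_ne (h : z' ≠ z) : (setCover w z s).down z' = s.down z' := by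
  rw [setCover]
  split_ifs
  · rfl
  · exact Function.update_of_ne h ..

theorem blk_setBlk_self (A : Matrix (Fin (rank w)) (Fin (rank z)) R) :
    (setBlk w z A s).blk w z = some A := by
  simp only [setBlk, Function.update_self]

theorem blk_setBlk_of_ne (A : Matrix (Fin (rank w)) (Fin (rank z)) R)
    (h : ¬ (w' = w ∧ z' = z)) : (setBlk w z A s).blk w' z' = s.blk w' z' := by
  obtain rfl | hw := eq_or_ne w' w
  · have hz : z' ≠ z := fun hz => h ⟨rfl, hz⟩
    simp only [setBlk, Function.update_self, Function.update_of_ne hz]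
  · simp only [setBlk, Function.update_of_ne hw]

theorem isSome_blk_setBlk (A : Matrix (Fin (rank w)) (Fin (rank z)) R) :
    ((setBlk w z A s).blk w' z').isSome = true ↔
      (w' = w ∧ z' = z) ∨ (s.blk w' z').isSome = true := by
  by_cases h : w' = w ∧ z' = z
  · obtain ⟨rfl, rfl⟩ := h
    simp [blk_setBlk_self]
  · rw [blk_setBlk_of_ne A h, or_iff_right h]

variable [Fintype X] [Ring R] {kit : MatrixKit R} {d : ℕ}

theorem Sound.mem_up_setCover (h : s.Sound kit d) :
    z' ∈ (setCover w z s).up w' ↔ (w' = w ∧ z' = z) ∨ z' ∈ s.up w' := by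
  obtain rfl | hw := eq_or_ne w' w
  · by_cases hb : (s.blk w' z).isSome
    · rw [setCover, if_pos hb]
      exact (or_iff_right_of_imp fun hz => hz.2 ▸ (h.mem_up _ _).2 hb).symm
    · simp [setCover, if_neg hb, or_comm]
  · rw [up_setCover_of_ne hw, or_iff_right fun hz => hw hz.1]

theorem Sound.mem_down_setCover (h : s.Sound kit d) :
    w' ∈ (setCover w z s).down z' ↔ (w' = w ∧ z' = z) ∨ w' ∈ s.down z' := by
  obtain rfl | hz := eq_or_ne z' z
  · by_cases hb : (s.blk w z').isSome
    · rw [setCover, if_pos hb]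
      exact (or_iff_right_of_imp fun hw => hw.1 ▸ (h.mem_down _ _).2 hb).symm
    · simp [setCover, if_neg hb, or_comm]
  · rw [down_setCover_of_ne hz, or_iff_right fun hw => hz hw.2]

theorem Sound.nodup_up_setCover (h : s.Sound kit d) (w' : X) :
    ((setCover w z s).up w').Nodup := by
  obtain rfl | hw := eq_or_ne w' w
  · rw [setCover]
    split_ifs with hb
    · exact h.nodup_up w'
    · simpa using (h.nodup_up w').concat (mt (h.mem_up _ _).1 hb)
  · rw [up_setCover_of_ne hw]
    exact h.nodup_up w'

theorem Sound.nodup_down_setCover (h : s.Sound kit d) (z' : X) :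
    ((setCover w z s).down z').Nodup := by
  obtain rfl | hz := eq_or_ne z' z
  · rw [setCover]
    split_ifs with hb
    · exact h.nodup_down z'
    · simpa using (h.nodup_down z').concat (mt (h.mem_down _ _).1 hb)
  · rw [down_setCover_of_ne hz]
    exact h.nodup_down z'

theorem Sound.setBlk_setCover (h : s.Sound kit d) (w z : X)
    (A : Matrix (Fin (rank w)) (Fin (rank z)) R) :
    (setBlk w z A (setCover w z s)).Sound kit d where
  nodup_up := h.nodup_up_setCover
  nodup_down := h.nodup_down_setCover
  mem_up w' z' := h.mem_up_setCover.trans <| by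
    rw [isSome_blk_setBlk, setCover_eq, h.mem_up]
  mem_down w' z' := h.mem_down_setCover.trans <| by
    rw [isSome_blk_setBlk, setCover_eq, h.mem_down]
  nodup_queue := by rw [setCover_eq]; exact h.nodup_queue
  length_pairs := by rw [setCover_eq]; exact h.length_pairs
  mem_le := by rw [setCover_eq]; exact h.mem_le
  work_le := by rw [setCover_eq]; exact h.work_le

end Cover

section Elimination

variable {R : Type u} {X : Type v} {rank : X → ℕ}

theorem time_foldl_le {α : Type*} {f : Store R X rank → α → Store R X rank} {t : ℕ}
    (h : ∀ s a, (f s a).time ≤ s.time + t) (l : List α) (s : Store R X rank) :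
    (l.foldl f s).time ≤ s.time + l.length * t := by
  induction l generalizing s with
  | nil => simp
  | cons a l ih =>
    rw [List.foldl_cons, List.length_cons]
    linarith [ih (f s a), h s a]

/-- The part of the store that is not affected by the elimination: the adjacency lists, the
matrices and the cost counters are reset. -/
def frame (s : Store R X rank) : Store R X rank :=
  { s with
    up := fun _ => [], down := fun _ => [], blk := fun _ _ => none
    time := 0, mem := 0, work := 0 }

variable [Ring R]

/-- The entry of the Schur complement that the elimination of `(x, y)` stores as `F_{wz}`, where
`B` is the matrix of `F_{xy}⁻¹`. -/
def schur (s : Store R X rank) (x y : X) (B : Matrix (Fin (rank y)) (Fin (rank x)) R) (w z : X) :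
    Matrix (Fin (rank w)) (Fin (rank z)) R :=
  s.getBlk w z - s.getBlk w y * B * s.getBlk x z

theorem schur_congr {s s' : Store R X rank} {x y w z : X}
    {B : Matrix (Fin (rank y)) (Fin (rank x)) R} (hwz : s'.blk w z = s.blk w z)
    (hwy : s'.blk w y = s.blk w y) (hxz : s'.blk x z = s.blk x z) :
    s'.schur x y B w z = s.schur x y B w z := by
  rw [schur, schur, getBlk, getBlk, getBlk, hwz, hwy, hxz]
  rfl

variable [Fintype X] [DecidableEq X] (kit : MatrixKit R) {d : ℕ} {x y : X}
  {B : Matrix (Fin (rank y)) (Fin (rank x)) R} {extra : ℕ} {s : Store R X rank}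

theorem blk_updateBlk (w z : X) :
    (updateBlk kit x y B extra z w s).blk = (setBlk w z (s.schur x y B w z) s).blk := by
  rw [schur, ← kit.mulRect_eq_mul, ← kit.mulRect_eq_mul, updateBlk, setCover_eq]
  rfl

theorem frame_updateBlk (w z : X) : (updateBlk kit x y B extra z w s).frame = s.frame := by
  rw [updateBlk, setCover_eq]
  rfl

theorem up_updateBlk_of_ne {w w' : X} (h : w' ≠ w) (z : X) :
    (updateBlk kit x y B extra z w s).up w' = s.up w' :=
  up_setCover_of_ne h

theorem time_updateBlk_le (hd : ∀ x, rank x ≤ d) (w z : X) :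
    (updateBlk kit x y B extra z w s).time ≤ s.time + 4 * kit.opTime d := by
  have hwyx := kit.mulTime_le_opTime (hd w) (hd y) (hd x)
  have hwxz := kit.mulTime_le_opTime (hd w) (hd x) (hd z)
  have hwz := kit.mul_add_two_le_opTime (hd w) (hd z)
  rw [updateBlk, setCover_eq]
  change s.time + _ ≤ _
  omega

variable {kit}

theorem Sound.updateBlk (h : s.Sound kit d) (hd : ∀ x, rank x ≤ d)
    (he : extra ≤ 8 * cells X d) (w z : X) :
    (updateBlk kit x y B extra z w s).Sound kit d := by
  have he₁ := MatrixKit.mulSize_le (hd w) (hd y) (hd x)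
  have he₂ := MatrixKit.mulSize_le (hd w) (hd x) (hd z)
  refine (((h.useWork (kit.mulRegs_le_opRegs he₁)).useWork
    (kit.mulRegs_le_opRegs he₂)).setBlk_setCover w z _).charge hd _ ?_
  have hwx := mul_le_cells (X := X) (hd w) (hd x)
  have hwz := mul_le_cells (X := X) (hd w) (hd z)
  have hsq₁ := mul_le_cells (X := X) he₁ he₁
  have hsq₂ := mul_le_cells (X := X) he₂ he₂
  rw [← sq] at hsq₁ hsq₂
  omega

variable (kit x y B extra) in
/-- The elimination step for `(x, y)` at the pairs `(w, z)` with `w` in a list. -/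
def eliminateRow (z : X) (ws : List X) (s : Store R X rank) : Store R X rank :=
  ws.foldl (fun s w => updateBlk kit x y B extra z w s) s

variable (kit x y B extra) in
/-- The elimination step for `(x, y)` at the pairs `(w, z)` with `w` and `z` in two lists. -/
def eliminate (zs ws : List X) (s : Store R X rank) : Store R X rank :=
  zs.foldl (fun s z => eliminateRow kit x y B extra z ws (s.charge 1 extra)) s

variable {zs ws : List X}

theorem eliminate_induction {P : Store R X rank → Prop} (hs : P s)
    (hcharge : ∀ s, P s → P (s.charge 1 extra))
    (hupdate : ∀ s, ∀ w ∈ ws, ∀ z, P s → P (updateBlk kit x y B extra z w s)) :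
    P (eliminate kit x y B extra zs ws s) :=
  List.foldlRecOn _ _ hs fun s hs z _ =>
    List.foldlRecOn _ _ (hcharge s hs) fun s hs w hw => hupdate s w hw z hs

theorem frame_eliminate : (eliminate kit x y B extra zs ws s).frame = s.frame :=
  eliminate_induction (P := fun s' => s'.frame = s.frame) rfl (fun _ h => h)
    fun _ w _ z h => (frame_updateBlk kit w z).trans h

theorem up_eliminate {w : X} (hw : w ∉ ws) :
    (eliminate kit x y B extra zs ws s).up w = s.up w :=
  eliminate_induction (P := fun s' => s'.up w = s.up w) rfl (fun _ h => h)
    fun _ _ hw' z h => (up_updateBlk_of_ne kit (ne_of_mem_of_not_mem hw' hw).symm z).trans h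

theorem Sound.eliminate (h : s.Sound kit d) (hd : ∀ x, rank x ≤ d) (he : extra ≤ 8 * cells X d) :
    (eliminate kit x y B extra zs ws s).Sound kit d :=
  eliminate_induction h (fun _ h => h.charge hd 1 (by omega))
    fun _ w _ z h => h.updateBlk hd he w z

theorem time_eliminate_le (hd : ∀ x, rank x ≤ d) :
    (eliminate kit x y B extra zs ws s).time ≤
      s.time + zs.length * (1 + ws.length * (4 * kit.opTime d)) := by
  refine time_foldl_le (fun s z => ?_) zs s
  rw [← add_assoc]
  exact time_foldl_le (fun s w => time_updateBlk_le kit hd w z) ws (s.charge 1 extra)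

theorem blk_eliminateRow {z : X} (hz : z ≠ y) (hx : x ∉ ws) (hws : ws.Nodup) (w' z' : X) :
    (eliminateRow kit x y B extra z ws s).blk w' z' =
      if w' ∈ ws ∧ z' = z then some (s.schur x y B w' z') else s.blk w' z' := by
  induction ws generalizing s with
  | nil => simp [eliminateRow]
  | cons w ws ih =>
    obtain ⟨hxw, hx⟩ := not_or.1 (mt List.mem_cons.2 hx)
    obtain ⟨hw, hws⟩ := List.nodup_cons.1 hws
    have hblk {a b : X} (h : ¬ (a = w ∧ b = z)) :
        (updateBlk kit x y B extra z w s).blk a b = s.blk a b := by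
      rw [blk_updateBlk, blk_setBlk_of_ne _ h]
    refine (ih hx hws).trans ?_
    by_cases hmem : w' ∈ ws ∧ z' = z
    · have hne := ne_of_mem_of_not_mem hmem.1 hw
      rw [if_pos hmem, if_pos ⟨List.mem_cons_of_mem _ hmem.1, hmem.2⟩]
      exact congrArg some (schur_congr (hblk fun h => hne h.1) (hblk fun h => hne h.1)
        (hblk fun h => hxw h.1))
    · rw [if_neg hmem]
      by_cases heq : w' = w ∧ z' = z
      · obtain ⟨rfl, rfl⟩ := heq
        rw [if_pos ⟨List.mem_cons_self, rfl⟩, blk_updateBlk, blk_setBlk_self]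
      · rw [hblk heq, if_neg]
        rintro ⟨h, hz'⟩
        exact (List.mem_cons.1 h).elim (fun h => heq ⟨h, hz'⟩) fun h => hmem ⟨h, hz'⟩

theorem blk_eliminate (hx : x ∉ ws) (hws : ws.Nodup) (hy : y ∉ zs) (hzs : zs.Nodup) (w' z' : X) :
    (eliminate kit x y B extra zs ws s).blk w' z' =
      if w' ∈ ws ∧ z' ∈ zs then some (s.schur x y B w' z') else s.blk w' z' := by
  induction zs generalizing s with
  | nil => simp [eliminate]
  | cons z zs ih =>
    obtain ⟨hyz, hy⟩ := not_or.1 (mt List.mem_cons.2 hy)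
    obtain ⟨hz, hzs⟩ := List.nodup_cons.1 hzs
    set s₁ := eliminateRow kit x y B extra z ws (s.charge 1 extra)
    have hrow (a b : X) : s₁.blk a b =
        if a ∈ ws ∧ b = z then some (s.schur x y B a b) else s.blk a b :=
      blk_eliminateRow (Ne.symm hyz) hx hws a b
    refine (ih hy hzs (s := s₁)).trans ?_
    by_cases hmem : w' ∈ ws ∧ z' ∈ zs
    · have hne := ne_of_mem_of_not_mem hmem.2 hz
      rw [if_pos hmem, if_pos ⟨hmem.1, List.mem_cons_of_mem _ hmem.2⟩]
      refine congrArg some (schur_congr ?_ ?_ ?_) <;> rw [hrow, if_neg]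
      exacts [fun h => hne h.2, fun h => hyz h.2, fun h => hne h.2]
    · rw [if_neg hmem, hrow]
      refine if_congr ?_ rfl rfl
      rw [List.mem_cons]
      tauto

end Elimination

section ReducePair

variable {R : Type u} [Ring R] {X : Type v} {rank : X → ℕ} [Fintype X] [DecidableEq X]

/-- The list of `x₊ \ {y}`. -/
def upperExcept (s : Store R X rank) (x y : X) : List X :=
  (s.up x).filter fun z => s.alive z && decide (z ≠ y)

/-- The temporary cells used by `ReducePair(x, y)`, where `low` lists `y₋`. -/
def reduceExtra (s : Store R X rank) (x y : X) (low : List X) : ℕ :=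
  2 * (s.upperExcept x y).length + 2 * (low.filter fun w => decide (w ≠ x)).length +
    2 * low.length + rank y * rank x

variable (kit : MatrixKit R) (x y : X) (B : Matrix (Fin (rank y)) (Fin (rank x)) R)
  (low : List X) (s : Store R X rank)

/-- The store in `ReducePair(x, y)` before `x` and `y` are removed. -/
def eliminated : Store R X rank :=
  eliminate kit x y B (s.reduceExtra x y low) (s.upperExcept x y)
    (low.filter fun w => decide (w ≠ x))
    (s.charge ((s.up x).length + low.length + 1) (s.reduceExtra x y low))

theorem reducePair_eq_charge :
    reducePair kit x y B low s =
      ({ remove y (remove x (eliminated kit x y B low s)) with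
          pairs := (x, y) ::
            (remove y (remove x (eliminated kit x y B low s))).pairs }).charge 1 0 :=
  rfl

theorem frame_eliminated : (eliminated kit x y B low s).frame = s.frame :=
  frame_eliminate

theorem reducePair_eq :
    reducePair kit x y B low s = { eliminated kit x y B low s with
      alive := Function.update (Function.update s.alive x false) y false
      cnt := fun z => s.cnt z - ((eliminated kit x y B low s).up x).count z -
        ((eliminated kit x y B low s).up y).count z
      pairs := (x, y) :: s.pairs
      time := (eliminated kit x y B low s).time + 1 +
        ((eliminated kit x y B low s).up x).length + 1 +
        ((eliminated kit x y B low s).up y).length + 1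
      mem := (reducePair kit x y B low s).mem } := by
  have hframe := frame_eliminated kit x y B low s
  have halive : (eliminated kit x y B low s).alive = s.alive := (congrArg alive hframe :)
  have hcnt : (eliminated kit x y B low s).cnt = s.cnt := (congrArg cnt hframe :)
  have hpairs : (eliminated kit x y B low s).pairs = s.pairs := (congrArg pairs hframe :)
  rw [← halive, ← hcnt, ← hpairs, reducePair_eq_charge, remove_eq, remove_eq]
  rfl

theorem alive_reducePair : (reducePair kit x y B low s).alive =
    Function.update (Function.update s.alive x false) y false := by
  rw [reducePair_eq]

theorem pairs_reducePair : (reducePair kit x y B low s).pairs = (x, y) :: s.pairs := by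
  rw [reducePair_eq]

theorem crit_reducePair : (reducePair kit x y B low s).crit = s.crit := by
  rw [reducePair_eq]
  exact (congrArg crit (frame_eliminated kit x y B low s) :)

theorem queue_reducePair : (reducePair kit x y B low s).queue = s.queue := by
  rw [reducePair_eq]
  exact (congrArg queue (frame_eliminated kit x y B low s) :)

theorem queued_reducePair : (reducePair kit x y B low s).queued = s.queued := by
  rw [reducePair_eq]
  exact (congrArg queued (frame_eliminated kit x y B low s) :)

variable {x y low s} {w z : X}

theorem up_reducePair (hw : w ∈ low → w = x) :
    (reducePair kit x y B low s).up w = s.up w := by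
  rw [reducePair_eq]
  refine up_eliminate fun hmem => ?_
  obtain ⟨hlow, hne⟩ := List.mem_filter.1 hmem
  exact of_decide_eq_true hne (hw hlow)

theorem cnt_reducePair (hy : y ∉ low) : (reducePair kit x y B low s).cnt =
    fun z => s.cnt z - (s.up x).count z - (s.up y).count z := by
  have hupx := up_reducePair (y := y) kit B (s := s) (low := low) (fun _ : x ∈ low => rfl)
  have hupy := up_reducePair (x := x) kit B (s := s) (fun h : y ∈ low => absurd h hy)
  rw [reducePair_eq] at hupx hupy
  rw [reducePair_eq, ← hupx, ← hupy]

theorem blk_reducePair (hs : (s.up x).Nodup) (hlow : low.Nodup) :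
    (reducePair kit x y B low s).blk w z =
      if (w ∈ low ∧ w ≠ x) ∧ (z ∈ s.up x ∧ s.alive z = true ∧ z ≠ y) then
        some (s.schur x y B w z)
      else s.blk w z := by
  rw [reducePair_eq]
  refine (blk_eliminate (by simp) (hlow.filter _) (by simp) (hs.filter _)
    w z).trans (if_congr ?_ rfl rfl)
  simp [and_assoc]

variable {d : ℕ} {kit}

theorem time_reducePair_le (hd : ∀ x, rank x ≤ d) (hy : y ∉ low) :
    (reducePair kit x y B low s).time ≤
      s.time + (2 * (s.up x).length + low.length + (s.up y).length + 4) +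
        (s.up x).length * (1 + (low.filter fun w => decide (w ≠ x)).length *
          (4 * kit.opTime d)) := by
  have hupx : (eliminated kit x y B low s).up x = s.up x := up_eliminate (by simp)
  have hupy : (eliminated kit x y B low s).up y = s.up y :=
    up_eliminate fun h => hy (List.mem_filter.1 h).1
  have helim : (eliminated kit x y B low s).time ≤ _ := time_eliminate_le hd
  have hlen : (s.upperExcept x y).length ≤ (s.up x).length := List.length_filter_le _ _
  have hmul := Nat.mul_le_mul_right (1 + (low.filter fun w => decide (w ≠ x)).length *
    (4 * kit.opTime d)) hlen
  rw [reducePair_eq, hupx, hupy]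
  simp only [Store.charge] at helim ⊢
  omega

theorem Sound.reduceExtra_le (h : s.Sound kit d) (hd : ∀ x, rank x ≤ d) (hlow : low.Nodup) :
    s.reduceExtra x y low ≤ 8 * cells X d := by
  have hupper : (s.upperExcept x y).length ≤ _ := ((h.nodup_up x).filter _).length_le_card
  have hlower := (hlow.filter fun w => decide (w ≠ x)).length_le_card
  have hlow := hlow.length_le_card
  have hcard := card_le_cells (X := X) (d := d)
  have hyx := mul_le_cells (X := X) (hd y) (hd x)
  rw [reduceExtra]
  omega

theorem Sound.reducePair (h : s.Sound kit d) (hd : ∀ x, rank x ≤ d) (hlow : low.Nodup)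
    (hpairs : s.pairs.length + 1 ≤ Fintype.card X) :
    (reducePair kit x y B low s).Sound kit d := by
  have he := h.reduceExtra_le (x := x) (y := y) hd hlow
  have helim : (eliminated kit x y B low s).Sound kit d :=
    (h.charge hd _ (by omega)).eliminate hd he
  have hremove := (helim.remove hd x).remove hd y
  set s₂ := Store.remove y (Store.remove x (eliminated kit x y B low s)) with hs₂
  have hlen : ((x, y) :: s₂.pairs).length ≤ Fintype.card X := by
    rw [hs₂, remove_eq, remove_eq]
    have hlength := congrArg (·.pairs.length + 1) (frame_eliminated kit x y B low s)
    exact hlength.trans_le hpairs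
  have hpush : ({ s₂ with pairs := (x, y) :: s₂.pairs }).Sound kit d :=
    { hremove with length_pairs := hlen }
  rw [reducePair_eq_charge]
  exact hpush.charge hd 1 (Nat.zero_le _)

end ReducePair

end Store

namespace Store

/-! ### The invariant of the algorithm -/

section Lower

variable {R : Type u} {X : Type v} {rank : X → ℕ} {s s' : Store R X rank} {x y : X}

/-- The list of `y₋`, without the elements that have been removed. -/
def lower (s : Store R X rank) (y : X) : List X := (s.down y).filter fun x => s.alive x

/-- The list of the non-critical elements of `y₋`. -/
def nonCritLower (s : Store R X rank) (y : X) : List X := (s.lower y).filter fun x => !s.crit x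

theorem mem_lower : x ∈ s.lower y ↔ x ∈ s.down y ∧ s.alive x = true := List.mem_filter

theorem mem_nonCritLower :
    x ∈ s.nonCritLower y ↔ x ∈ s.down y ∧ s.alive x = true ∧ s.crit x = false := by
  simp [nonCritLower, mem_lower, and_assoc]

theorem length_lower_le (s : Store R X rank) (y : X) : (s.lower y).length ≤ (s.down y).length :=
  List.length_filter_le _ _

theorem alive_eq_of_core_eq (h : s'.core = s.core) : s'.alive = s.alive :=
  (congrArg alive h :)

theorem crit_eq_of_core_eq (h : s'.core = s.core) : s'.crit = s.crit :=
  (congrArg crit h :)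

theorem down_eq_of_core_eq (h : s'.core = s.core) : s'.down = s.down :=
  (congrArg down h :)

theorem lower_eq_of_core_eq (h : s'.core = s.core) : s'.lower = s.lower :=
  (congrArg lower h :)

end Lower

variable {R : Type u} [Ring R]

/-- The condition for calling `ReducePair(x, y)`: the only non-critical element of `y₋` is `x`,
and `B` is the matrix of `F_{xy}⁻¹`. -/
structure IsReducible {X : Type v} {rank : X → ℕ} (kit : MatrixKit R) (s : Store R X rank)
    (x y : X) (B : Matrix (Fin (rank y)) (Fin (rank x)) R) : Prop where
  alive_snd : s.alive y = true
  crit_snd : s.crit y = false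
  nonCritLower_eq : s.nonCritLower y = [x]
  invRect_eq : kit.invRect (s.getBlk x y) = some B

namespace IsReducible

variable {X : Type v} {rank : X → ℕ} {kit : MatrixKit R} {s s' : Store R X rank} {x y w : X}
  {B : Matrix (Fin (rank y)) (Fin (rank x)) R}

theorem of_core_eq (h : s.IsReducible kit x y B) (hcore : s'.core = s.core) :
    s'.IsReducible kit x y B where
  alive_snd := alive_eq_of_core_eq hcore ▸ h.alive_snd
  crit_snd := crit_eq_of_core_eq hcore ▸ h.crit_snd
  nonCritLower_eq := (congrFun (congrArg nonCritLower hcore :) y).trans h.nonCritLower_eq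
  invRect_eq :=
    (congrArg (fun t : Store R X rank => kit.invRect (t.getBlk x y)) hcore).trans h.invRect_eq

theorem mem_nonCritLower_iff (h : s.IsReducible kit x y B) :
    w ∈ s.down y ∧ s.alive w = true ∧ s.crit w = false ↔ w = x := by
  rw [← mem_nonCritLower, h.nonCritLower_eq, List.mem_singleton]

theorem mem_down (h : s.IsReducible kit x y B) : x ∈ s.down y :=
  (h.mem_nonCritLower_iff.2 rfl).1

theorem alive_fst (h : s.IsReducible kit x y B) : s.alive x = true :=
  (h.mem_nonCritLower_iff.2 rfl).2.1

theorem crit_fst (h : s.IsReducible kit x y B) : s.crit x = false :=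
  (h.mem_nonCritLower_iff.2 rfl).2.2

theorem eq_fst_of_mem_lower (h : s.IsReducible kit x y B) (hw : w ∈ s.lower y)
    (hc : s.crit w = false) : w = x :=
  h.mem_nonCritLower_iff.1 ⟨(mem_lower.1 hw).1, (mem_lower.1 hw).2, hc⟩

theorem crit_ne (hr : s.IsReducible kit x y B) (hw : s.crit w = true) : w ≠ x ∧ w ≠ y := by
  constructor <;> rintro rfl
  · simp [hr.crit_fst] at hw
  · simp [hr.crit_snd] at hw

end IsReducible

theorem Sound.nodup_lower {X : Type v} [Fintype X] {rank : X → ℕ} {kit : MatrixKit R} {d : ℕ}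
    {s : Store R X rank} (h : s.Sound kit d) (y : X) : (s.lower y).Nodup :=
  (h.nodup_down y).filter _

section Count

variable {X : Type v} [PartialOrder X] [Finite X] {I : Input.{u, v, w} R X}

theorem ncard_sub_count_up [DecidableEq X] {P : X → Prop} {x : X} (hx : P x) (z : X) :
    Set.ncard {w | w ⋖ z ∧ P w} - (I.up x).count z = Set.ncard {w | w ⋖ z ∧ P w ∧ w ≠ x} := by
  have hset : {w | w ⋖ z ∧ P w ∧ w ≠ x} = {w | w ⋖ z ∧ P w} \ {x} := by
    ext w
    simp [and_assoc]
  rw [hset]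
  by_cases hxz : x ⋖ z
  · rw [List.count_eq_one_of_mem (I.nodup_up x) ((I.mem_up x z).2 hxz),
      Set.ncard_sdiff_singleton_of_mem (show x ∈ {w | w ⋖ z ∧ P w} from ⟨hxz, hx⟩)]
  · rw [List.count_eq_zero_of_not_mem (mt (I.mem_up x z).1 hxz), Nat.sub_zero,
      Set.sdiff_singleton_eq_self fun h => hxz h.1]

end Count

variable {X : Type v} [PartialOrder X] [Fintype X]

/-- The pairs reduced so far form a reduction sequence, the present elements are those it leaves
unmatched, and the stored covering relation and matrices between them are those of its Morse
data. Elements that are not marked as critical still have their original upper covers. -/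
structure Represents (I : Input.{u, v, w} R X) (s : Store R X I.rank) : Prop where
  up_eq : ∀ w, s.crit w = false → s.up w = I.up w
  crit_alive : ∀ x, s.crit x = true → s.alive x = true
  alive_iff : ∀ x, s.alive x = true ↔ IsCritical {r | r ∈ s.pairs} x
  seq : IsReductionSeq I.F.toBlockData s.pairs
  free : ∀ x, s.alive x = true → s.crit x = false → ∀ r ∈ s.pairs, ¬ x ⋖ r.2
  dim_blk : ∀ w z, (s.blk w z).isSome = true → I.dim z = I.dim w + 1
  covers : ∀ w z, s.alive w = true → s.alive z = true →
    ((s.blk w z).isSome = true ↔ MorseCovers {r | r ∈ s.pairs} w z)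
  getBlk_eq : ∀ w z, s.alive w = true → s.alive z = true →
    s.getBlk w z = I.matrixOf (morseMap I.F.toBlockData {r | r ∈ s.pairs} w z)
  cnt_eq : ∀ z, s.cnt z = Set.ncard {x | x ⋖ z ∧ s.alive x = true ∧ s.crit x = false}

theorem represents_core {I : Input.{u, v, w} R X} {s : Store R X I.rank} :
    s.core.Represents I ↔ s.Represents I :=
  ⟨fun h => { h with }, fun h => { h with }⟩

theorem Represents.of_core_eq {I : Input.{u, v, w} R X} {s s' : Store R X I.rank}
    (h : s.Represents I) (hcore : s'.core = s.core) : s'.Represents I :=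
  represents_core.1 (hcore ▸ represents_core.2 h)

variable (I : Input.{u, v, w} R X) (kit : MatrixKit R)

/-- The invariant of the algorithm. -/
structure Invariant (s : Store R X I.rank) : Prop extends
    Sound kit I.maxRank s, Represents I s

variable {I kit} {s : Store R X I.rank} {x y z : X}

theorem Invariant.of_core_eq {s' : Store R X I.rank} (h : s.Invariant I kit)
    (hs' : s'.Sound kit I.maxRank) (hcore : s'.core = s.core) : s'.Invariant I kit :=
  ⟨hs', h.toRepresents.of_core_eq hcore⟩

theorem Invariant.mem_down_iff (h : s.Invariant I kit) (hx : s.crit x = false) :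
    x ∈ s.down y ↔ x ⋖ y := by
  rw [h.mem_down, ← h.mem_up, h.up_eq x hx, I.mem_up]

theorem Invariant.mark [DecidableEq X] (h : s.Invariant I kit) (ha : s.alive x = true)
    (hc : s.crit x = false) : (mark x s).Invariant I kit := by
  have hcrit (w : X) : Function.update s.crit x true w = false ↔ s.crit w = false ∧ w ≠ x := by
    obtain rfl | hw := eq_or_ne w x
    · simp
    · simp [hw]
  refine ⟨h.toSound.mark I.rank_le_maxRank x, ?_⟩
  rw [mark_eq]
  refine { h.toRepresents with
    up_eq := fun w hw => h.up_eq w ((hcrit w).1 hw).1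
    crit_alive := fun w hw => ?_
    free := fun w hw hwc => h.free w hw ((hcrit w).1 hwc).1
    cnt_eq := fun z => ?_ }
  · obtain rfl | hne := eq_or_ne w x
    · exact ha
    · exact h.crit_alive w ((Function.update_of_ne hne ..).symm.trans hw)
  · dsimp only
    rw [h.cnt_eq, h.up_eq x hc,
      ncard_sub_count_up (P := fun w => s.alive w = true ∧ s.crit w = false) ⟨ha, hc⟩]
    simp only [hcrit, and_assoc]

/-! ### `ReducePair` preserves the invariant -/

section ReducePair

variable {B : Matrix (Fin (I.rank y)) (Fin (I.rank x)) R}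

namespace IsReducible

theorem covBy (hr : s.IsReducible kit x y B) (h : s.Invariant I kit) : x ⋖ y :=
  (h.mem_down_iff hr.crit_fst).1 hr.mem_down

theorem notMem_lower (hr : s.IsReducible kit x y B) (h : s.Invariant I kit) : y ∉ s.lower y :=
  fun hy => ((h.mem_down_iff hr.crit_snd).1 (mem_lower.1 hy).1).lt.false

theorem getBlk_mul (hr : s.IsReducible kit x y B) (h : s.Invariant I kit) :
    I.matrixOf (morseMap I.F.toBlockData {r | r ∈ s.pairs} x y) * B = 1 ∧
      B * I.matrixOf (morseMap I.F.toBlockData {r | r ∈ s.pairs} x y) = 1 := by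
  rw [← h.getBlk_eq x y hr.alive_fst hr.alive_snd]
  exact kit.mul_eq_one_of_invRect_eq_some hr.invRect_eq

theorem isReductionSeq_cons (hr : s.IsReducible kit x y B) (h : s.Invariant I kit) :
    IsReductionSeq I.F.toBlockData ((x, y) :: s.pairs) := by
  have hfree := h.free x hr.alive_fst hr.crit_fst
  have hbij := I.bijective_of_matrixOf_mul_eq_one (hr.getBlk_mul h).1 (hr.getBlk_mul h).2
  rw [morseMap_of_free (S := {r | r ∈ s.pairs}) I.F.toBlockData hfree] at hbij
  exact ⟨h.seq, hr.covBy h, hbij, (h.alive_iff x).1 hr.alive_fst, (h.alive_iff y).1 hr.alive_snd,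
    hfree⟩

theorem length_pairs_lt (hr : s.IsReducible kit x y B) (h : s.Invariant I kit) :
    s.pairs.length + 1 ≤ Fintype.card X := by
  simpa using (hr.isReductionSeq_cons h).nodup_map_fst.length_le_card

theorem free_cons (hr : s.IsReducible kit x y B) (h : s.Invariant I kit)
    {w : X} (hw : s.alive w = true) (hwc : s.crit w = false) (hwx : w ≠ x) :
    ∀ r ∈ (x, y) :: s.pairs, ¬ w ⋖ r.2 :=
  List.forall_mem_cons.2 ⟨fun hwy => hwx <| hr.eq_fst_of_mem_lower
    (mem_lower.2 ⟨(h.mem_down_iff hwc).2 hwy, hw⟩) hwc, h.free w hw hwc⟩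

variable [DecidableEq X] {w : X}

theorem sound_reducePair (hr : s.IsReducible kit x y B) (h : s.Invariant I kit) :
    (reducePair kit x y B (s.lower y) s).Sound kit I.maxRank :=
  h.toSound.reducePair B I.rank_le_maxRank (h.nodup_lower y) (hr.length_pairs_lt h)

theorem alive_reducePair_iff (hr : s.IsReducible kit x y B) :
    (reducePair kit x y B (s.lower y) s).alive z = true ↔
      s.alive z = true ∧ z ≠ x ∧ z ≠ y := by
  rw [alive_reducePair]
  obtain rfl | hzy := eq_or_ne z y
  · simp
  obtain rfl | hzx := eq_or_ne z x
  · simp [hzy]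
  · simp [hzx, hzy]

theorem up_reducePair (hr : s.IsReducible kit x y B) (h : s.Invariant I kit)
    (hw : s.crit w = false) : (reducePair kit x y B (s.lower y) s).up w = I.up w := by
  rw [Store.up_reducePair kit B fun hmem => hr.eq_fst_of_mem_lower hmem hw, h.up_eq w hw]

theorem blk_reducePair (h : s.Invariant I kit) (hz : s.alive z = true) (hw : s.alive w = true)
    (hwx : w ≠ x) (hzy : z ≠ y) :
    (reducePair kit x y B (s.lower y) s).blk w z =
      if (s.blk w y).isSome = true ∧ (s.blk x z).isSome = true then
        some (s.schur x y B w z)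
      else s.blk w z := by
  rw [Store.blk_reducePair kit B (h.nodup_up x) (h.nodup_lower y)]
  refine if_congr ?_ rfl rfl
  rw [mem_lower, h.mem_up, h.mem_down]
  tauto

theorem isSome_blk_of_isSome_blk_reducePair (h : s.Invariant I kit)
    (hwz : ((reducePair kit x y B (s.lower y) s).blk w z).isSome = true) :
    (s.blk w z).isSome = true ∨ ((s.blk w y).isSome = true ∧ (s.blk x z).isSome = true) := by
  rw [Store.blk_reducePair kit B (h.nodup_up x) (h.nodup_lower y)] at hwz
  split_ifs at hwz with hnew
  · exact Or.inr ⟨(h.mem_down w y).1 (mem_lower.1 hnew.1.1).1, (h.mem_up x z).1 hnew.2.1⟩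
  · exact Or.inl hwz

theorem getBlk_reducePair (h : s.Invariant I kit) (hz : s.alive z = true) (hw : s.alive w = true)
    (hwx : w ≠ x) (hzy : z ≠ y) :
    (reducePair kit x y B (s.lower y) s).getBlk w z = s.schur x y B w z := by
  rw [getBlk, blk_reducePair h hz hw hwx hzy]
  split_ifs with hnew
  · rfl
  · have hzero : s.getBlk w y = 0 ∨ s.getBlk x z = 0 := by
      rw [not_and_or, Option.not_isSome_iff_eq_none, Option.not_isSome_iff_eq_none] at hnew
      exact hnew.imp (by rw [getBlk, ·]; rfl) (by rw [getBlk, ·]; rfl)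
    change s.getBlk w z = _
    rcases hzero with hzero | hzero <;> simp [schur, hzero]

theorem dim_blk_reducePair (hr : s.IsReducible kit x y B) (h : s.Invariant I kit)
    (hwz : ((reducePair kit x y B (s.lower y) s).blk w z).isSome = true) :
    I.dim z = I.dim w + 1 := by
  rcases isSome_blk_of_isSome_blk_reducePair h hwz with hwz | ⟨hwy, hxz⟩
  · exact h.dim_blk w z hwz
  · have hdim_wy := h.dim_blk w y hwy
    have hdim_xz := h.dim_blk x z hxz
    have hdim_xy := I.dim_covBy x y (hr.covBy h)
    omega

theorem covers_reducePair (hr : s.IsReducible kit x y B) (h : s.Invariant I kit)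
    (hz : s.alive z = true) (hw : s.alive w = true) (hwx : w ≠ x) (hzy : z ≠ y) :
    ((reducePair kit x y B (s.lower y) s).blk w z).isSome = true ↔
      MorseCovers {r | r ∈ (x, y) :: s.pairs} w z := by
  rw [(hr.isReductionSeq_cons h).morseCovers_cons, ← h.covers w z hw hz,
    ← h.covers x z hr.alive_fst hz, ← h.covers w y hw hr.alive_snd,
    blk_reducePair h hz hw hwx hzy]
  split_ifs with hnew
  · simp [hnew]
  · tauto

theorem getBlk_reducePair_eq (hr : s.IsReducible kit x y B) (h : s.Invariant I kit)
    (hz : s.alive z = true) (hw : s.alive w = true) (hwx : w ≠ x) (hzy : z ≠ y) :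
    (reducePair kit x y B (s.lower y) s).getBlk w z =
      I.matrixOf (morseMap I.F.toBlockData {r | r ∈ (x, y) :: s.pairs} w z) := by
  have hinv := Input.matrixOf_linInv (hr.getBlk_mul h).1 (hr.getBlk_mul h).2
  rw [getBlk_reducePair h hz hw hwx hzy, schur,
    (hr.isReductionSeq_cons h).morseMap_cons I.F.map_eq_zero, I.matrixOf_sub, I.matrixOf_comp,
    I.matrixOf_comp, hinv, h.getBlk_eq w z hw hz, h.getBlk_eq w y hw hr.alive_snd,
    h.getBlk_eq x z hr.alive_fst hz]

theorem cnt_reducePair_eq (hr : s.IsReducible kit x y B) (h : s.Invariant I kit) (z : X) :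
    (reducePair kit x y B (s.lower y) s).cnt z =
      Set.ncard {w | w ⋖ z ∧ (reducePair kit x y B (s.lower y) s).alive w = true ∧
        s.crit w = false} := by
  rw [cnt_reducePair kit B (hr.notMem_lower h)]
  dsimp only
  rw [h.up_eq x hr.crit_fst, h.up_eq y hr.crit_snd, h.cnt_eq,
    ncard_sub_count_up (P := fun w => s.alive w = true ∧ s.crit w = false)
      ⟨hr.alive_fst, hr.crit_fst⟩,
    ncard_sub_count_up (P := fun w => (s.alive w = true ∧ s.crit w = false) ∧ w ≠ x)
      ⟨⟨hr.alive_snd, hr.crit_snd⟩, (hr.covBy h).lt.ne'⟩]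
  congr 1
  ext w
  simp only [Set.mem_ofPred_eq, hr.alive_reducePair_iff]
  tauto

theorem invariant_reducePair (hr : s.IsReducible kit x y B) (h : s.Invariant I kit) :
    (reducePair kit x y B (s.lower y) s).Invariant I kit where
  __ := hr.sound_reducePair h
  up_eq w hw := hr.up_reducePair h (by rwa [crit_reducePair] at hw)
  crit_alive w hw := by
    rw [crit_reducePair] at hw
    exact hr.alive_reducePair_iff.2 ⟨h.crit_alive w hw, hr.crit_ne hw⟩
  alive_iff w := by
    rw [hr.alive_reducePair_iff, pairs_reducePair, List.setOfPred_mem_cons, isCritical_insert,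
      h.alive_iff]
  seq := by
    rw [pairs_reducePair]
    exact hr.isReductionSeq_cons h
  free w hw hwc := by
    rw [pairs_reducePair]
    rw [crit_reducePair] at hwc
    obtain ⟨hw, hwx, -⟩ := hr.alive_reducePair_iff.1 hw
    exact hr.free_cons h hw hwc hwx
  dim_blk w z := hr.dim_blk_reducePair h
  covers w z hw hz := by
    obtain ⟨hw, hwx, -⟩ := hr.alive_reducePair_iff.1 hw
    obtain ⟨hz, -, hzy⟩ := hr.alive_reducePair_iff.1 hz
    rw [pairs_reducePair]
    exact hr.covers_reducePair h hz hw hwx hzy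
  getBlk_eq w z hw hz := by
    obtain ⟨hw, hwx, -⟩ := hr.alive_reducePair_iff.1 hw
    obtain ⟨hz, -, hzy⟩ := hr.alive_reducePair_iff.1 hz
    rw [pairs_reducePair]
    exact hr.getBlk_reducePair_eq h hz hw hwx hzy
  cnt_eq z := by
    rw [crit_reducePair]
    exact hr.cnt_reducePair_eq h z

end IsReducible

end ReducePair

end Store

namespace Store

/-! ### The inner loop -/

section CritCount

variable {X : Type v} [Finite X]

/-- The number of critical elements of dimension `k`. -/
def critCount (dim : X → ℕ) (crit : X → Bool) (k : ℕ) : ℕ :=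
  Set.ncard {x | crit x = true ∧ dim x = k}

theorem length_le_critCount {dim : X → ℕ} {crit : X → Bool} {k : ℕ} {l : List X} (hl : l.Nodup)
    (h : ∀ x ∈ l, crit x = true ∧ dim x = k) : l.length ≤ critCount dim crit k := by
  classical
  rw [← List.toFinset_card_of_nodup hl, ← Set.ncard_coe_finset]
  exact Set.ncard_le_ncard fun x hx => h x (List.mem_toFinset.1 hx)

end CritCount

section Subroutines

variable {R : Type u} [Ring R] {X : Type v} [Fintype X] {rank : X → ℕ} {kit : MatrixKit R}
  {dim : X → ℕ} {k : ℕ} {y : X} {s : Store R X rank}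

/-- Find the non-critical elements of `y₋`. -/
def scan (y : X) (s : Store R X rank) : Store R X rank :=
  s.charge ((s.down y).length + (s.lower y).length + 1)
    (2 * (s.lower y).length + 2 * (s.nonCritLower y).length)

/-- Try to invert `F_{xy}`, while holding the lists found by `scan`. -/
def probe (kit : MatrixKit R) (x y : X) (s : Store R X rank) : Store R X rank :=
  (s.useWork (kit.invRegs (rank x) (rank y))).charge (kit.invTime (rank x) (rank y))
    (2 * (s.lower y).length + 2 * (s.nonCritLower y).length + 2 * (rank x * rank y))

/-- Take the front element off the queue, leaving `q`. -/
def dequeue (q : List X) (s : Store R X rank) : Store R X rank :=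
  ({ s with queue := q }).charge 1 0

variable [DecidableEq X]

/-- The first half of the pass for `y`: enqueue `x₊ \ {y}` and call `ReducePair(x, y)`, if there
is an `x` to which this applies. -/
def tryReduce (kit : MatrixKit R) (dim : X → ℕ) (k : ℕ) (y : X) (s : Store R X rank) :
    Store R X rank :=
  match s.nonCritLower y with
  | [x] =>
    match kit.invRect (s.getBlk x y) with
    | some B => reducePair kit x y B (s.lower y) (enqueue dim k (s.up x) ((s.scan y).probe kit x y))
    | none => (s.scan y).probe kit x y
  | _ => s.scan y

theorem process_eq : process kit dim k y s =
    enqueue dim k ((tryReduce kit dim k y s).up y) (tryReduce kit dim k y s) := by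
  rw [tryReduce]
  rfl

theorem process_of_nonCritLower_eq_nil (h : s.nonCritLower y = []) :
    process kit dim k y s = enqueue dim k (s.up y) (s.scan y) := by
  rw [process_eq, tryReduce, h]
  rfl

theorem tryReduce_induction {P : Store R X rank → Prop} (ha : s.alive y = true)
    (hc : s.crit y = false) (hscan : P (s.scan y)) (hprobe : ∀ x, P ((s.scan y).probe kit x y))
    (hreduce : ∀ x B, s.IsReducible kit x y B →
      P (reducePair kit x y B (s.lower y)
        (enqueue dim k (s.up x) ((s.scan y).probe kit x y)))) :
    P (tryReduce kit dim k y s) := by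
  rw [tryReduce]
  split
  next x hx =>
    split
    next B hB => exact hreduce x B ⟨ha, hc, hx, hB⟩
    next => exact hprobe x
  next => exact hscan

theorem innerLoop_of_queue_eq_cons {N : ℕ} {q : List X} (h : s.queue = y :: q) :
    innerLoop kit dim k (N + 1) s =
      innerLoop kit dim k N (process kit dim k y (s.dequeue q)) := by
  rw [innerLoop, h]
  rfl

end Subroutines

variable {R : Type u} [Ring R] {X : Type v} [PartialOrder X] [Fintype X]
  {I : Input.{u, v, w} R X} {kit : MatrixKit R} {s s' s'' : Store R X I.rank} {k t t' : ℕ}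
  {x y : X}

theorem Invariant.length_down_le (h : s.Invariant I kit) (hy : I.dim y = k + 1) :
    (s.down y).length ≤ (I.down y).length + critCount I.dim s.crit k := by
  rw [List.length_eq_length_filter_add (l := s.down y) fun x => !s.crit x]
  refine Nat.add_le_add (List.Subperm.length_le
    (List.subperm_of_subset ((h.nodup_down y).filter _) fun x hx => ?_))
    (length_le_critCount ((h.nodup_down y).filter _) fun x hx => ?_)
  · simp only [List.mem_filter, Bool.not_eq_true'] at hx
    exact (I.mem_down x y).2 ((h.mem_down_iff hx.2).1 hx.1)
  · simp only [List.mem_filter, Bool.not_not] at hx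
    have := h.dim_blk x y ((h.mem_down x y).1 hx.1)
    exact ⟨hx.2, by omega⟩

theorem IsReducible.length_filter_lower_le [DecidableEq X]
    {B : Matrix (Fin (I.rank y)) (Fin (I.rank x)) R} (hr : s.IsReducible kit x y B)
    (h : s.Invariant I kit) (hy : I.dim y = k + 1) :
    ((s.lower y).filter fun w => decide (w ≠ x)).length ≤ critCount I.dim s.crit k := by
  refine length_le_critCount ((h.nodup_lower y).filter _) fun w hw => ?_
  simp only [List.mem_filter, decide_eq_true_eq] at hw
  have := h.dim_blk w y ((h.mem_down w y).1 (mem_lower.1 hw.1).1)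
  exact ⟨by simpa using mt (hr.eq_fst_of_mem_lower hw.1) hw.2, by omega⟩

/-- The effect of a part of the inner loop: invariants are kept, no element becomes critical or
stops being pending, and at most `t` units of time are spent. -/
structure Step (I : Input.{u, v, w} R X) (kit : MatrixKit R) (k : ℕ)
    (s s' : Store R X I.rank) (t : ℕ) : Prop where
  inv : s'.Invariant I kit
  queueOK : s'.QueueOK I.dim k
  crit_eq : s'.crit = s.crit
  pending_eq : s'.Pending = s.Pending
  time_le : s'.time ≤ s.time + t

namespace Step

theorem trans (h : Step I kit k s s' t) (h' : Step I kit k s' s'' t') :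
    Step I kit k s s'' (t + t') :=
  ⟨h'.inv, h'.queueOK, h'.crit_eq.trans h.crit_eq, h'.pending_eq.trans h.pending_eq, by
    have := h.time_le; have := h'.time_le; omega⟩

theorem mono (h : Step I kit k s s' t) (ht : t ≤ t') : Step I kit k s s' t' :=
  { h with time_le := h.time_le.trans (Nat.add_le_add_left ht _) }

theorem scan (h : s.Invariant I kit) (hq : s.QueueOK I.dim k) (y : X) :
    Step I kit k s (s.scan y) (2 * (s.down y).length + 1) := by
  have hlow := s.length_lower_le y
  have hsound : (s.scan y).Sound kit I.maxRank := by
    have hnon : (s.nonCritLower y).length ≤ (s.lower y).length := List.length_filter_le _ _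
    have hcard := (h.nodup_lower y).length_le_card
    have hcells : Fintype.card X ≤ cells X I.maxRank := card_le_cells
    exact h.toSound.charge I.rank_le_maxRank _ (by omega)
  exact ⟨h.of_core_eq hsound rfl, hq.charge _ _, rfl, rfl, Nat.add_le_add_left (by omega) _⟩

theorem probe (h : s.Invariant I kit) (hq : s.QueueOK I.dim k) (x y : X) :
    Step I kit k s (s.probe kit x y) (kit.opTime I.maxRank) := by
  have hx := I.rank_le_maxRank x
  have hy := I.rank_le_maxRank y
  have hsound : (s.probe kit x y).Sound kit I.maxRank := by
    have hnon : (s.nonCritLower y).length ≤ (s.lower y).length := List.length_filter_le _ _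
    have hcard := (h.nodup_lower y).length_le_card
    have hcells : Fintype.card X ≤ cells X I.maxRank := card_le_cells
    have hmul := mul_le_cells (X := X) hx hy
    exact (h.toSound.useWork (kit.invRegs_le_opRegs hx hy)).charge I.rank_le_maxRank _ (by omega)
  exact ⟨h.of_core_eq hsound rfl, ⟨hq.nodup, hq.queued, hq.alive, hq.crit, hq.dim⟩, rfl, rfl,
    Nat.add_le_add_left (kit.invTime_le_opTime hx hy) _⟩

variable [DecidableEq X]

theorem enqueue (h : s.Invariant I kit) (hq : s.QueueOK I.dim k) (l : List X) :
    Step I kit k s (enqueue I.dim k l s) l.length :=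
  ⟨h.of_core_eq (h.toSound.enqueue I.rank_le_maxRank hq l) (core_enqueue l), hq.enqueue l,
    crit_eq_of_core_eq (core_enqueue l), pending_enqueue l, (time_enqueue l).le⟩

end Step

/-- The state in which the pass of the inner loop for `y` starts. -/
structure IsDequeued (dim : X → ℕ) (k : ℕ) (y : X) {rank : X → ℕ} (s : Store R X rank) :
    Prop where
  alive : s.alive y = true
  crit : s.crit y = false
  dim_eq : dim y = k + 1
  not_pending : ¬ s.Pending y

variable (I kit) in
/-- A bound for the time of a call of `ReducePair(x, y)` for an element `y` with `l` lower covers,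
if there are `M` critical elements of the dimension of `x`. -/
def reduceCost (l M : ℕ) : ℕ :=
  3 * maxCovers X + l + 4 + maxCovers X * (1 + M * (4 * kit.opTime I.maxRank))

variable (I kit) in
/-- A bound for the time of the pass of the inner loop for `y`, in terms of the number `M` of
critical elements one dimension below. -/
def passCost (M : ℕ) (y : X) : ℕ :=
  3 * (I.down y).length + (3 * M + kit.opTime I.maxRank + 6 * maxCovers X + 5 +
    maxCovers X * (M * (4 * kit.opTime I.maxRank)))

open Classical in
/-- The set of pending elements. -/
def pendingSet (s : Store R X I.rank) : Finset X := {z | s.Pending z}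

theorem mem_pendingSet {z : X} : z ∈ s.pendingSet ↔ s.Pending z := by
  simp [pendingSet]

theorem Step.pendingSet_eq (h : Step I kit k s s' t) : s'.pendingSet = s.pendingSet := by
  ext z
  rw [mem_pendingSet, mem_pendingSet, h.pending_eq]

section Dequeue

variable {q : List X}

theorem Invariant.dequeue (h : s.Invariant I kit) (hq : q.Nodup) :
    (s.dequeue q).Invariant I kit :=
  h.of_core_eq ((h.toSound.setQueue hq s.queued).charge I.rank_le_maxRank 1 (Nat.zero_le _)) rfl

theorem QueueOK.dequeue (hq : s.QueueOK I.dim k) (hs : s.queue = y :: q) :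
    (s.dequeue q).QueueOK I.dim k := by
  obtain ⟨hnodup, hqueued, halive, hcrit, hdim⟩ := hq
  rw [hs] at hnodup hqueued halive hcrit hdim
  exact ⟨hnodup.of_cons, (List.forall_mem_cons.1 hqueued).2, (List.forall_mem_cons.1 halive).2,
    (List.forall_mem_cons.1 hcrit).2, (List.forall_mem_cons.1 hdim).2⟩

theorem QueueOK.isDequeued (hq : s.QueueOK I.dim k) (hs : s.queue = y :: q) :
    (s.dequeue q).IsDequeued I.dim k y := by
  have hy : y ∈ s.queue := hs ▸ List.mem_cons_self
  refine ⟨hq.alive y hy, hq.crit y hy, hq.dim y hy, ?_⟩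
  rintro (hmem | hflag)
  · exact (List.nodup_cons.1 (hs ▸ hq.nodup)).1 hmem
  · exact Bool.false_ne_true (hflag.symm.trans (hq.queued y hy))

end Dequeue

variable [DecidableEq X]

namespace IsReducible

variable {B : Matrix (Fin (I.rank y)) (Fin (I.rank x)) R}

theorem queueOK_reducePair (hr : s.IsReducible kit x y B) (h : s.Invariant I kit)
    (hq : s.QueueOK I.dim k) (hy : s.IsDequeued I.dim k y) :
    (reducePair kit x y B (s.lower y) s).QueueOK I.dim k := by
  have hxy := I.dim_covBy x y (hr.covBy h)
  refine ⟨?_, ?_, ?_, ?_, ?_⟩ <;> simp only [queue_reducePair]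
  · exact hq.nodup
  · simpa only [queued_reducePair] using hq.queued
  · refine fun z hz => hr.alive_reducePair_iff.2 ⟨hq.alive z hz, ?_, ?_⟩
    · rintro rfl
      have := hq.dim z hz
      have := hy.dim_eq
      omega
    · rintro rfl
      exact hy.not_pending (Or.inl hz)
  · simpa only [crit_reducePair] using hq.crit
  · exact hq.dim

theorem time_reducePair_le (hr : s.IsReducible kit x y B) (h : s.Invariant I kit)
    (hy : I.dim y = k + 1) :
    (reducePair kit x y B (s.lower y) s).time ≤
      s.time + reduceCost I kit (s.down y).length (critCount I.dim s.crit k) := by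
  have htime := Store.time_reducePair_le (kit := kit) (B := B) (s := s) I.rank_le_maxRank
    (hr.notMem_lower h)
  have hupx := I.length_up_le x
  have hupy := I.length_up_le y
  have hlow := s.length_lower_le y
  have hnew := Nat.mul_le_mul hupx (Nat.add_le_add_left (Nat.mul_le_mul_right
    (4 * kit.opTime I.maxRank) (hr.length_filter_lower_le h hy)) 1)
  rw [h.up_eq x hr.crit_fst, h.up_eq y hr.crit_snd] at htime
  rw [reduceCost]
  omega

theorem step_reducePair (hr : s.IsReducible kit x y B) (h : s.Invariant I kit)
    (hq : s.QueueOK I.dim k) (hy : s.IsDequeued I.dim k y) :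
    Step I kit k s (reducePair kit x y B (s.lower y) s)
      (reduceCost I kit (s.down y).length (critCount I.dim s.crit k)) where
  inv := hr.invariant_reducePair h
  queueOK := hr.queueOK_reducePair h hq hy
  crit_eq := crit_reducePair ..
  pending_eq := by
    ext z
    simp only [Pending, queue_reducePair, queued_reducePair]
  time_le := hr.time_reducePair_le h hy.dim_eq

theorem step_enqueue_reducePair (hr : s.IsReducible kit x y B) (h : s.Invariant I kit)
    (hq : s.QueueOK I.dim k) (hy : s.IsDequeued I.dim k y) :
    Step I kit k s
      (reducePair kit x y B (s.lower y) (enqueue I.dim k (s.up x) ((s.scan y).probe kit x y)))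
      (2 * (s.down y).length + 1 + kit.opTime I.maxRank + maxCovers X +
        reduceCost I kit (s.down y).length (critCount I.dim s.crit k)) := by
  have hscan := Step.scan h hq y
  have hprobe := hscan.trans (Step.probe hscan.inv hscan.queueOK x y)
  have henq := hprobe.trans (Step.enqueue hprobe.inv hprobe.queueOK (s.up x))
  have hcore : (enqueue I.dim k (s.up x) ((s.scan y).probe kit x y)).core = s.core :=
    core_enqueue _
  have hred := (hr.of_core_eq hcore).step_reducePair henq.inv henq.queueOK
    ⟨alive_eq_of_core_eq hcore ▸ hy.alive, henq.crit_eq ▸ hy.crit, hy.dim_eq,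
      henq.pending_eq ▸ hy.not_pending⟩
  rw [lower_eq_of_core_eq hcore, down_eq_of_core_eq hcore, crit_eq_of_core_eq hcore] at hred
  refine (henq.trans hred).mono ?_
  have := I.length_up_le x
  rw [h.up_eq x hr.crit_fst]
  omega

end IsReducible

theorem Step.tryReduce (h : s.Invariant I kit) (hq : s.QueueOK I.dim k)
    (hy : s.IsDequeued I.dim k y) :
    Step I kit k s (tryReduce kit I.dim k y s)
      (2 * (s.down y).length + 1 + kit.opTime I.maxRank + maxCovers X +
        reduceCost I kit (s.down y).length (critCount I.dim s.crit k)) := by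
  have hscan := Step.scan h hq y
  refine tryReduce_induction (P := fun s' => Step I kit k s s' _) hy.alive hy.crit
    (hscan.mono (by omega)) (fun x => ?_) fun x B hr => hr.step_enqueue_reducePair h hq hy
  exact (hscan.trans (Step.probe hscan.inv hscan.queueOK x y)).mono (by omega)

theorem Step.process (h : s.Invariant I kit) (hq : s.QueueOK I.dim k)
    (hy : s.IsDequeued I.dim k y) :
    Step I kit k s (process kit I.dim k y s)
      (passCost I kit (critCount I.dim s.crit k) y) := by
  have htry := Step.tryReduce h hq hy
  have hup := htry.inv.up_eq y (htry.crit_eq ▸ hy.crit)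
  rw [process_eq]
  refine (htry.trans (Step.enqueue htry.inv htry.queueOK _)).mono ?_
  have := h.length_down_le hy.dim_eq
  have := I.length_up_le y
  rw [hup, reduceCost, passCost, mul_add, mul_one]
  omega

theorem pendingSet_eq_insert {q : List X} (hs : s.queue = y :: q) :
    s.pendingSet = insert y (s.dequeue q).pendingSet := by
  ext z
  rw [Finset.mem_insert, mem_pendingSet, mem_pendingSet, Pending, hs, List.mem_cons, or_assoc]
  rfl

theorem Invariant.exists_innerLoop_eq (N : ℕ) (h : s.Invariant I kit)
    (hq : s.QueueOK I.dim k) (hN : s.pendingSet.card < N) :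
    ∃ s', innerLoop kit I.dim k N s = some s' ∧ s'.Invariant I kit ∧ s'.crit = s.crit ∧
      s'.time ≤ s.time + 1 +
        ∑ z ∈ s.pendingSet, (passCost I kit (critCount I.dim s.crit k) z + 1) := by
  induction N generalizing s with
  | zero => omega
  | succ N ih =>
    rcases hs : s.queue with _ | ⟨y, q⟩
    · refine ⟨s.charge 1 0, ?_, h.of_core_eq (h.toSound.charge I.rank_le_maxRank 1
        (Nat.zero_le _)) rfl, rfl, Nat.le_add_right _ _⟩
      rw [innerLoop, hs]
    · have hy := hq.isDequeued hs
      have hstep := Step.process (h.dequeue (hs ▸ hq.nodup).of_cons) (hq.dequeue hs) hy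
      have hnotMem : y ∉ (s.dequeue q).pendingSet := mt mem_pendingSet.1 hy.not_pending
      rw [pendingSet_eq_insert hs, Finset.card_insert_of_notMem hnotMem] at hN
      obtain ⟨s', hs', hinv, hcrit, htime⟩ :=
        ih hstep.inv hstep.queueOK (by rw [hstep.pendingSet_eq]; omega)
      refine ⟨s', (innerLoop_of_queue_eq_cons hs).trans hs', hinv,
        hcrit.trans hstep.crit_eq, ?_⟩
      have hpass := hstep.time_le
      rw [hstep.pendingSet_eq, hstep.crit_eq] at htime
      rw [pendingSet_eq_insert hs, Finset.sum_insert hnotMem]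
      have hdeq : (s.dequeue q).time = s.time + 1 := rfl
      have hcr : (s.dequeue q).crit = s.crit := rfl
      rw [hcr] at htime hpass
      omega

end Store

namespace Store

/-! ### The outer loop -/

section CritSquares

variable {X : Type v} {dim : X → ℕ} {crit : X → Bool} {c : X}

section Update

variable [Finite X] [DecidableEq X]

theorem critCount_update (dim : X → ℕ) (hc : crit c = false) (k : ℕ) :
    critCount dim (Function.update crit c true) k =
      critCount dim crit k + if k = dim c then 1 else 0 := by
  have hupdate (x : X) : Function.update crit c true x = true ↔ x = c ∨ crit x = true := by
    obtain rfl | hx := eq_or_ne x c <;> simp [*]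
  simp only [critCount, hupdate]
  split_ifs with hk
  · subst hk
    rw [← Set.ncard_insert_of_notMem (a := c) (by simp [hc])]
    congr 1
    ext x
    simp only [Set.mem_ofPred_eq, Set.mem_insert_iff]
    refine ⟨fun h => h.1.imp_right fun hx => ⟨hx, h.2⟩, ?_⟩
    rintro (rfl | h)
    · exact ⟨Or.inl rfl, rfl⟩
    · exact ⟨Or.inr h.1, h.2⟩
  · rw [add_zero]
    congr 1
    ext x
    refine and_congr_left fun hx => or_iff_right ?_
    rintro rfl
    exact hk hx.symm

theorem ncard_crit_eq_false_update_lt (hc : crit c = false) :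
    Set.ncard {x | Function.update crit c true x = false} < Set.ncard {x | crit x = false} := by
  refine Set.ncard_lt_ncard ⟨fun x hx => ?_, fun hsub => ?_⟩
  · obtain rfl | hne := eq_or_ne x c
    · exact hc
    · rwa [Set.mem_ofPred_eq, Function.update_of_ne hne] at hx
  · simpa using hsub hc

end Update

variable [Fintype X]

/-- The sum of the squares of the numbers of critical elements of each dimension. -/
def critSquares (dim : X → ℕ) (crit : X → Bool) : ℕ :=
  ∑ k ∈ Finset.univ.image dim, critCount dim crit k ^ 2

theorem one_le_critSquares (hc : crit c = true) : 1 ≤ critSquares dim crit := by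
  have hpos : 0 < critCount dim crit (dim c) := (Set.ncard_pos).2 ⟨c, hc, rfl⟩
  exact (Nat.one_le_pow 2 _ hpos).trans
    (Finset.single_le_sum (f := fun k => critCount dim crit k ^ 2) (fun _ _ => Nat.zero_le _)
      (Finset.mem_image_of_mem dim (Finset.mem_univ c)))

theorem critSquares_add_critCount_update_le [DecidableEq X] (dim : X → ℕ) (hc : crit c = false) :
    critSquares dim crit + critCount dim (Function.update crit c true) (dim c) ≤
      critSquares dim (Function.update crit c true) := by
  have hmem : dim c ∈ Finset.univ.image dim := Finset.mem_image_of_mem _ (Finset.mem_univ c)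
  simp only [critSquares, critCount_update dim hc, if_true]
  calc ∑ k ∈ Finset.univ.image dim, critCount dim crit k ^ 2 + (critCount dim crit (dim c) + 1)
      = ∑ k ∈ Finset.univ.image dim, (critCount dim crit k ^ 2 +
          if k = dim c then critCount dim crit (dim c) + 1 else 0) := by
        rw [Finset.sum_add_distrib, Finset.sum_ite_eq', if_pos hmem]
    _ ≤ ∑ k ∈ Finset.univ.image dim, (critCount dim crit k + if k = dim c then 1 else 0) ^ 2 := by
        refine Finset.sum_le_sum fun k _ => ?_
        split_ifs with hk
        · rw [hk]; nlinarith
        · rfl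

end CritSquares

variable {R : Type u} [Ring R] {X : Type v} [PartialOrder X] [Fintype X]
  {I : Input.{u, v, w} R X} {kit : MatrixKit R} {s s' : Store R X I.rank} {k : ℕ} {c x y : X}

theorem passCost_add_one_le (M : ℕ) (y : X) :
    passCost I kit M y + 1 ≤ 3 * (I.down y).length +
      14 * ((maxCovers X + 1) * (M + 1) * kit.opTime I.maxRank) := by
  have hT := kit.one_le_opTime I.maxRank
  rw [passCost]
  generalize kit.opTime I.maxRank = T at hT
  generalize maxCovers X = p
  have hlin : 3 * M + 6 * p + 6 ≤ (3 * M + 6 * p + 6) * T := Nat.le_mul_of_pos_right _ hT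
  nlinarith [Nat.zero_le (p * M * T), Nat.zero_le (p * T), Nat.zero_le (M * T)]

theorem sum_passCost_le (M : ℕ) (t : Finset X) :
    ∑ z ∈ t, (passCost I kit M z + 1) ≤ 3 * (Fintype.card X * maxCovers X) +
      Fintype.card X * (14 * ((maxCovers X + 1) * (M + 1) * kit.opTime I.maxRank)) :=
  calc ∑ z ∈ t, (passCost I kit M z + 1)
      ≤ ∑ z, (3 * (I.down z).length +
          14 * ((maxCovers X + 1) * (M + 1) * kit.opTime I.maxRank)) :=
        (Finset.sum_le_sum_of_subset t.subset_univ).trans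
          (Finset.sum_le_sum fun z _ => passCost_add_one_le M z)
    _ = 3 * ∑ z, (I.down z).length +
          Fintype.card X * (14 * ((maxCovers X + 1) * (M + 1) * kit.opTime I.maxRank)) := by
        rw [Finset.sum_add_distrib, ← Finset.mul_sum, Finset.sum_const, Finset.card_univ,
          smul_eq_mul]
    _ ≤ _ := Nat.add_le_add_right (Nat.mul_le_mul_left _ I.sum_length_down_le) _

variable (I kit) in
/-- A bound for the time of one pass of the outer loop, per critical element of the dimension of
the element selected. -/
def passTime : ℕ :=
  35 * ((Fintype.card X + 1) * (maxCovers X + 1) * kit.opTime I.maxRank)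

theorem le_passTime_mul {M : ℕ} (hM : 1 ≤ M) :
    4 * Fintype.card X + 2 * maxCovers X + 7 + (3 * (Fintype.card X * maxCovers X) +
      Fintype.card X * (14 * ((maxCovers X + 1) * (M + 1) * kit.opTime I.maxRank))) ≤
    passTime I kit * M := by
  have hT := kit.one_le_opTime I.maxRank
  rw [passTime]
  generalize kit.opTime I.maxRank = T at hT
  generalize Fintype.card X = n
  generalize maxCovers X = p
  have hlow : 4 * n + 2 * p + 7 + 3 * (n * p) ≤ 7 * ((n + 1) * (p + 1) * (T * M)) := by
    have := Nat.le_mul_of_pos_right ((n + 1) * (p + 1)) (Nat.mul_pos hT hM)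
    nlinarith
  have hmain : n * (14 * ((p + 1) * (M + 1) * T)) ≤ 28 * ((n + 1) * (p + 1) * (T * M)) :=
    calc n * (14 * ((p + 1) * (M + 1) * T)) ≤ (n + 1) * (14 * ((p + 1) * (M + M) * T)) := by
          gcongr
          omega
      _ = 28 * ((n + 1) * (p + 1) * (T * M)) := by ring
  calc _ ≤ 7 * ((n + 1) * (p + 1) * (T * M)) + 28 * ((n + 1) * (p + 1) * (T * M)) := by omega
    _ = 35 * ((n + 1) * (p + 1) * T) * M := by ring

theorem Invariant.crit_of_covBy (h : s.Invariant I kit) (hcnt : s.cnt c = 0) (hx : x ⋖ c)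
    (ha : s.alive x = true) : s.crit x = true := by
  have hempty := h.cnt_eq c
  rw [hcnt, eq_comm, Set.ncard_eq_zero] at hempty
  by_contra hc
  exact Set.eq_empty_iff_forall_notMem.1 hempty x ⟨hx, ha, by simpa using hc⟩

theorem Invariant.exists_cnt_eq_zero (h : s.Invariant I kit) (ha : s.alive x = true)
    (hc : s.crit x = false) : ∃ c, s.alive c = true ∧ s.crit c = false ∧ s.cnt c = 0 := by
  obtain ⟨c, ⟨hac, hcc⟩, hmin⟩ := Set.exists_min_image
    {x | s.alive x = true ∧ s.crit x = false} I.dim (Set.toFinite _) ⟨x, ha, hc⟩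
  refine ⟨c, hac, hcc, ?_⟩
  rw [h.cnt_eq, Set.ncard_eq_zero]
  refine Set.eq_empty_of_forall_notMem fun z hz => ?_
  have hdim := I.dim_covBy z c hz.1
  have hle := hmin z hz.2
  omega

theorem Invariant.crit_of_find?_eq_none (h : s.Invariant I kit)
    (hfind : I.elems.find? (fun c => s.alive c && !s.crit c && decide (s.cnt c = 0)) = none)
    (x : X) (hx : s.alive x = true) : s.crit x = true := by
  by_contra hxc
  obtain ⟨c, hac, hcc, hcnt⟩ := h.exists_cnt_eq_zero hx (by simpa using hxc)
  simpa [hac, hcc, hcnt] using List.find?_eq_none.1 hfind c (I.mem_elems c)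

variable [DecidableEq X]

theorem Invariant.resetQueue (h : s.Invariant I kit) (c : X) :
    (resetQueue c s).Invariant I kit :=
  h.of_core_eq ((h.toSound.setQueue (List.nodup_singleton c) _).charge I.rank_le_maxRank _
    (Nat.zero_le _)) rfl

theorem Step.process_of_nonCritLower_eq_nil (h : s.Invariant I kit) (hq : s.QueueOK I.dim k)
    (hnil : s.nonCritLower y = []) :
    Step I kit k s (Store.process kit I.dim k y s)
      (2 * (s.down y).length + 1 + (s.up y).length) := by
  rw [Store.process_of_nonCritLower_eq_nil hnil]
  have hscan := Step.scan h hq y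
  exact hscan.trans (Step.enqueue hscan.inv hscan.queueOK _)

/-- The state in which the first pass of the inner loop for `c` starts. -/
def select (c : X) (s : Store R X I.rank) : Store R X I.rank :=
  (resetQueue c (mark c s)).dequeue []

theorem up_select : (select c s).up = s.up := (congrArg up (mark_eq c s) :)

theorem down_select : (select c s).down = s.down := (congrArg down (mark_eq c s) :)

theorem alive_select : (select c s).alive = s.alive := (congrArg alive (mark_eq c s) :)

theorem crit_select : (select c s).crit = Function.update s.crit c true :=
  (congrArg crit (mark_eq c s) :)

theorem time_select :
    (select c s).time = s.time + 1 + (s.up c).length + (Fintype.card X + 2) + 1 :=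
  (congrArg (fun s => s.time + (Fintype.card X + 2) + 1) (mark_eq c s) :)

theorem Invariant.select (h : s.Invariant I kit) (ha : s.alive c = true)
    (hc : s.crit c = false) : (select c s).Invariant I kit :=
  ((h.mark ha hc).resetQueue c).dequeue List.nodup_nil

theorem Invariant.nonCritLower_select_eq_nil (h : s.Invariant I kit) (hcnt : s.cnt c = 0) :
    (Store.select c s).nonCritLower c = [] := by
  refine List.eq_nil_iff_forall_not_mem.2 fun x hx => ?_
  obtain ⟨hxc, hxa, hcrit⟩ := mem_nonCritLower.1 hx
  rw [down_select] at hxc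
  rw [alive_select] at hxa
  rw [crit_select] at hcrit
  obtain rfl | hne := eq_or_ne x c
  · simp at hcrit
  · rw [Function.update_of_ne hne] at hcrit
    have hlt := (h.mem_down_iff hcrit).1 hxc
    simp [h.crit_of_covBy hcnt hlt hxa] at hcrit

theorem Invariant.exists_innerLoop_select (h : s.Invariant I kit) (ha : s.alive c = true)
    (hc : s.crit c = false) (hcnt : s.cnt c = 0) {N : ℕ} (hN : Fintype.card X + 2 ≤ N) :
    ∃ s', innerLoop kit I.dim (I.dim c) N (Store.resetQueue c (Store.mark c s)) = some s' ∧
      s'.Invariant I kit ∧ s'.crit = Function.update s.crit c true ∧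
      s'.time + Fintype.card X + 1 ≤ s.time + passTime I kit *
        critCount I.dim (Function.update s.crit c true) (I.dim c) := by
  obtain ⟨N, rfl⟩ : ∃ N', N = N' + 1 := ⟨N - 1, by omega⟩
  have hsel := h.select ha hc
  have hqueue : (Store.select c s).QueueOK I.dim (I.dim c) := by
    constructor <;> simp [Store.select, Store.dequeue, charge]
  have hfirst := Step.process_of_nonCritLower_eq_nil hsel hqueue
    (h.nonCritLower_select_eq_nil hcnt)
  have hpending := Finset.card_le_univ
    (process kit I.dim (I.dim c) c (Store.select c s)).pendingSet
  obtain ⟨s', hs', hinv, hcrit, htime⟩ :=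
    hfirst.inv.exists_innerLoop_eq N hfirst.queueOK (by omega)
  rw [hfirst.crit_eq, crit_select] at hcrit htime
  refine ⟨s', (innerLoop_of_queue_eq_cons rfl).trans hs', hinv, hcrit, ?_⟩
  have hM : 1 ≤ critCount I.dim (Function.update s.crit c true) (I.dim c) := by
    rw [critCount_update I.dim hc, if_pos rfl]
    omega
  have hstart := hfirst.time_le
  rw [time_select, up_select, h.up_eq c hc] at hstart
  have hup := I.length_up_le c
  have hdown := (hsel.nodup_down c).length_le_card
  have hsum := sum_passCost_le (I := I) (kit := kit)
    (critCount I.dim (Function.update s.crit c true) (I.dim c))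
    (process kit I.dim (I.dim c) c (Store.select c s)).pendingSet
  have hpass := le_passTime_mul (I := I) (kit := kit) hM
  omega

theorem Invariant.exists_outerLoop_eq {M N : ℕ} (hM : Fintype.card X + 2 ≤ M)
    (h : s.Invariant I kit) (hN : Set.ncard {x | s.crit x = false} < N) :
    ∃ out, outerLoop kit I.dim I.elems M N s = some out ∧ out.Invariant I kit ∧
      (∀ x, out.alive x = true → out.crit x = true) ∧
      ((∃ x, s.alive x = true) → ∃ x, out.crit x = true) ∧
      out.time + passTime I kit * critSquares I.dim s.crit ≤
        s.time + Fintype.card X + 1 + passTime I kit * critSquares I.dim out.crit := by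
  induction N generalizing s with
  | zero => omega
  | succ N ih =>
    have hinv₁ : (s.charge (I.elems.length + 1) 0).Invariant I kit :=
      h.of_core_eq (h.toSound.charge I.rank_le_maxRank _ (Nat.zero_le _)) rfl
    have htime₁ : (s.charge (I.elems.length + 1) 0).time = s.time + Fintype.card X + 1 := by
      rw [← I.length_elems]
      rfl
    have hcrit₁ : (s.charge (I.elems.length + 1) 0).crit = s.crit := rfl
    rw [outerLoop]
    split
    next hfind =>
      have hall := h.crit_of_find?_eq_none hfind
      exact ⟨_, rfl, hinv₁, hall, fun ⟨x, hx⟩ => ⟨x, hall x hx⟩, by rw [htime₁]; rfl⟩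
    next c hfind =>
      have hc := List.find?_some hfind
      simp only [Bool.and_eq_true, Bool.not_eq_true', decide_eq_true_eq] at hc
      obtain ⟨⟨hac, hcc⟩, hcnt⟩ := hc
      obtain ⟨s', hs', hinv', hcrit', htime'⟩ := hinv₁.exists_innerLoop_select hac hcc hcnt hM
      have hlt := ncard_crit_eq_false_update_lt hcc
      rw [← hcrit'] at hlt
      obtain ⟨out, hout, hinv, hall, hex, htime⟩ := ih hinv' (hlt.trans_le (Nat.le_of_lt_succ hN))
      refine ⟨out, ?_, hinv, hall, fun _ => hex ⟨c, hinv'.crit_alive c (by simp [hcrit'])⟩, ?_⟩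
      · rw [hs', Option.bind_some, hout]
      · have hsq := Nat.mul_le_mul_left (passTime I kit)
          (critSquares_add_critCount_update_le I.dim hcc)
        rw [Nat.mul_add, ← hcrit'] at hsq
        rw [← hcrit', htime₁] at htime'
        rw [hcrit₁] at hsq
        omega

end Store

/-! ### The whole run -/

namespace Input

variable {R : Type u} [Ring R] {X : Type v} [PartialOrder X]

section Load

variable [Fintype X] (I : Input.{u, v, w} R X)

theorem isSome_load_blk (x y : X) : (I.load.blk x y).isSome = true ↔ x ⋖ y := by
  simp only [load]
  split_ifs with h <;> simp [h]

theorem getBlk_load (x y : X) : I.load.getBlk x y = I.matrixOf (I.F.map x y) := by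
  simp only [load, Store.getBlk]
  split_ifs with h
  · rfl
  · rw [I.F.map_eq_zero x y h, I.matrixOf_zero]
    rfl

theorem sound_load (kit : MatrixKit R) : I.load.Sound kit I.maxRank where
  nodup_up := I.nodup_up
  nodup_down := I.nodup_down
  mem_up w z := (I.mem_up w z).trans (I.isSome_load_blk w z).symm
  mem_down w z := (I.mem_down w z).trans (I.isSome_load_blk w z).symm
  nodup_queue := List.nodup_nil
  length_pairs := Nat.zero_le _
  mem_le := Nat.zero_le _
  work_le := Nat.zero_le _

variable [DecidableEq X]

theorem foldl_initCounters (l : List X) (s : Store R X I.rank) :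
    ∃ m, l.foldl (fun s x => ({ s with
        cnt := Function.update s.cnt x (s.down x).length }).charge ((s.down x).length + 1) 0) s =
      { s with
        cnt := fun z => if z ∈ l then (s.down z).length else s.cnt z
        time := s.time + (l.map fun x => (s.down x).length + 1).sum
        mem := m } := by
  induction l generalizing s with
  | nil => exact ⟨s.mem, by simp⟩
  | cons a l ih =>
    obtain ⟨m, hm⟩ := ih (({ s with
        cnt := Function.update s.cnt a (s.down a).length }).charge ((s.down a).length + 1) 0)
    refine ⟨m, ?_⟩
    rw [List.foldl_cons, hm]
    simp only [Store.charge, List.map_cons, List.sum_cons, List.mem_cons, add_assoc]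
    congr 1
    funext z
    obtain rfl | hz := eq_or_ne z a <;> simp [*]

theorem initCounters_load_eq : I.initCounters I.load =
    { I.load with
      cnt := fun z => (I.down z).length
      time := ∑ x, ((I.down x).length + 1)
      mem := (I.initCounters I.load).mem } := by
  obtain ⟨m, hm⟩ := I.foldl_initCounters I.elems (I.load.charge 0 0)
  have huniv : I.elems.toFinset = Finset.univ :=
    Finset.eq_univ_of_forall fun x => List.mem_toFinset.2 (I.mem_elems x)
  have hsum : (I.elems.map fun x => (I.down x).length + 1).sum = ∑ x, ((I.down x).length + 1) := by
    rw [← List.sum_toFinset _ I.nodup_elems, huniv]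
  rw [initCounters, hm]
  simp [Store.charge, I.mem_elems, load, ← hsum]

theorem sound_initCounters (kit : MatrixKit R) :
    (I.initCounters I.load).Sound kit I.maxRank :=
  List.foldlRecOn _ _ ((I.sound_load kit).charge I.rank_le_maxRank 0 (Nat.zero_le _))
    fun s h _ _ => (h.setFlags s.alive s.crit _).charge I.rank_le_maxRank _ (Nat.zero_le _)

theorem represents_initCounters : (I.initCounters I.load).Represents I := by
  have hfree (w : X) : ∀ r ∈ {r | r ∈ ([] : List (X × X))}, ¬ w ⋖ r.2 := by simp
  rw [initCounters_load_eq]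
  constructor
  case up_eq => exact fun _ _ => rfl
  case crit_alive => exact fun _ _ => rfl
  case alive_iff => exact fun x => iff_of_true rfl fun z => ⟨List.not_mem_nil, List.not_mem_nil⟩
  case seq => exact trivial
  case free => exact fun x _ _ => hfree x
  case dim_blk => exact fun w z h => I.dim_covBy w z ((I.isSome_load_blk w z).1 h)
  case covers =>
    exact fun w z _ _ => (I.isSome_load_blk w z).trans (morseCovers_of_free (hfree w)).symm
  case getBlk_eq =>
    refine fun w z _ _ => (I.getBlk_load w z).trans (congrArg _ ?_)
    exact (morseMap_of_free I.F.toBlockData (hfree w) z).symm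
  case cnt_eq =>
    intro z
    change (I.down z).length = Set.ncard {x | x ⋖ z ∧ true = true ∧ false = false}
    rw [← List.toFinset_card_of_nodup (I.nodup_down z), ← Set.ncard_coe_finset]
    congr 1
    ext x
    simp [I.mem_down]

theorem invariant_initCounters (kit : MatrixKit R) :
    (I.initCounters I.load).Invariant I kit :=
  ⟨I.sound_initCounters kit, I.represents_initCounters⟩

theorem time_initCounters_le : (I.initCounters I.load).time ≤
    Fintype.card X * maxCovers X + Fintype.card X := by
  have := I.sum_length_down_le
  rw [initCounters_load_eq]
  simp only [Finset.sum_add_distrib, Finset.sum_const, Finset.card_univ, smul_eq_mul, mul_one]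
  omega

end Load

theorem critSq_eq_critSquares [Fintype X] (I : Input.{u, v, w} R X) {S : Set (X × X)}
    {crit : X → Bool} (h : ∀ x, crit x = true ↔ IsCritical S x) :
    I.critSq S = Store.critSquares I.dim crit := by
  simp only [critSq, Store.critSquares, Store.critCount, h]

end Input

variable {R : Type u} [Ring R] {X : Type v} [PartialOrder X] [Fintype X]

namespace Store

/-- The state of the memory in which the algorithm stops: only critical elements remain. -/
structure IsFinal (I : Input.{u, v, w} R X) (kit : MatrixKit R) (out : Store R X I.rank) : Prop
    extends Invariant I kit out where
  crit_of_alive : ∀ x, out.alive x = true → out.crit x = true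
  exists_crit : Nonempty X → ∃ x, out.crit x = true
  time_le : out.time ≤ Fintype.card X * maxCovers X + 2 * Fintype.card X + 1 +
    passTime I kit * critSquares I.dim out.crit

end Store

theorem Input.exists_scythe_eq_some [DecidableEq X] (I : Input.{u, v, w} R X)
    (kit : MatrixKit R) : ∃ N out, I.scythe kit N = some out ∧ out.IsFinal I kit := by
  have halive (x : X) : (I.initCounters I.load).alive x = true := by
    rw [I.initCounters_load_eq]
    rfl
  have hcard : Set.ncard {x | (I.initCounters I.load).crit x = false} < Fintype.card X + 2 := by
    have := Set.ncard_le_card {x | (I.initCounters I.load).crit x = false}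
    rw [Nat.card_eq_fintype_card] at this
    omega
  obtain ⟨out, hout, hinv, hcrit, hex, htime⟩ :=
    (I.invariant_initCounters kit).exists_outerLoop_eq le_rfl hcard
  have hinit := I.time_initCounters_le
  exact ⟨_, out, hout, hinv, hcrit, fun ⟨x⟩ => hex ⟨x, halive x⟩, by omega⟩

theorem nonempty_of_one_le_maxCovers {X : Type v} [PartialOrder X] [Fintype X]
    (hp : 1 ≤ maxCovers X) : Nonempty X := by
  by_contra hX
  rw [not_nonempty_iff] at hX
  simp [maxCovers] at hp

namespace Store.IsFinal

variable {I : Input.{u, v, w} R X} {kit : MatrixKit R} {out : Store R X I.rank}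

theorem crit_iff (h : out.IsFinal I kit) (x : X) :
    out.crit x = true ↔ IsCritical {q | q ∈ out.pairs} x :=
  ⟨fun hx => (h.alive_iff x).1 (h.crit_alive x hx),
    fun hx => h.crit_of_alive x ((h.alive_iff x).2 hx)⟩

theorem isSome_blk_iff (h : out.IsFinal I kit) {m m' : X}
    (hm : IsCritical {q | q ∈ out.pairs} m) (hm' : IsCritical {q | q ∈ out.pairs} m') :
    (out.blk m m').isSome = true ↔ MorseCovers {q | q ∈ out.pairs} m m' :=
  h.covers m m' ((h.alive_iff m).2 hm) ((h.alive_iff m').2 hm')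

theorem time_le_mul (h : out.IsFinal I kit) (hp : 1 ≤ maxCovers X) :
    out.time ≤ 144 * (Fintype.card X * maxCovers X * I.critSq {q | q ∈ out.pairs} *
      kit.opTime I.maxRank) := by
  have := nonempty_of_one_le_maxCovers hp
  obtain ⟨c, hc⟩ := h.exists_crit this
  have hsq := one_le_critSquares (dim := I.dim) hc
  have hT := kit.one_le_opTime I.maxRank
  have hn : 1 ≤ Fintype.card X := Fintype.card_pos
  have htime := h.time_le
  rw [I.critSq_eq_critSquares h.crit_iff]
  rw [passTime] at htime
  generalize critSquares I.dim out.crit = Φ at *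
  generalize kit.opTime I.maxRank = T at *
  generalize Fintype.card X = n at *
  generalize maxCovers X = p at *
  calc out.time ≤ n * p + 2 * n + 1 + 35 * ((n + 1) * (p + 1) * T) * Φ := htime
    _ ≤ 4 * (n * p * (Φ * T)) + 35 * ((n + n) * (p + p) * T) * Φ := by
        have h1 : n * p ≤ n * p * (Φ * T) := Nat.le_mul_of_pos_right _ (Nat.mul_pos hsq hT)
        have h2 : n ≤ n * p := Nat.le_mul_of_pos_right _ hp
        gcongr
        omega
    _ = 144 * (n * p * Φ * T) := by ring

theorem mem_le_mul (h : out.IsFinal I kit) (hp : 1 ≤ maxCovers X)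
    (hd : 1 ≤ I.maxRank) :
    out.mem ≤ 768 * (Fintype.card X ^ 2 * maxCovers X * I.maxRank ^ 2) := by
  have := nonempty_of_one_le_maxCovers hp
  have hn : 1 ≤ Fintype.card X := Fintype.card_pos
  calc out.mem ≤ 48 * ((Fintype.card X + 1) ^ 2 * (I.maxRank + 1) ^ 2) := h.mem_le
    _ ≤ 48 * ((2 * Fintype.card X) ^ 2 * (2 * I.maxRank) ^ 2) := by gcongr <;> omega
    _ = 768 * (Fintype.card X ^ 2 * 1 * I.maxRank ^ 2) := by ring
    _ ≤ _ := by gcongr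

theorem work_le_mul (h : out.IsFinal I kit) (hp : 1 ≤ maxCovers X)
    (hd : 1 ≤ I.maxRank) {W : ℕ} (hW : kit.HasWorkspace W) :
    out.work ≤ (kit.mulRegs 0 + W) * (Fintype.card X ^ 2 * maxCovers X * I.maxRank ^ 2) := by
  have := nonempty_of_one_le_maxCovers hp
  have hnp : 1 ≤ Fintype.card X ^ 2 * maxCovers X :=
    Nat.mul_pos (Nat.pow_pos Fintype.card_pos) hp
  calc out.work ≤ kit.opRegs I.maxRank := h.work_le
    _ ≤ kit.mulRegs 0 + W * I.maxRank ^ 2 := hW.opRegs_le hd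
    _ ≤ (kit.mulRegs 0 + W) * I.maxRank ^ 2 := by
        rw [add_mul]
        exact Nat.add_le_add_right (Nat.le_mul_of_pos_right _ (Nat.pow_pos hd)) _
    _ ≤ _ := Nat.mul_le_mul_left _ (Nat.le_mul_of_pos_left _ hnp)

theorem time_le_mul_rpow (h : out.IsFinal I kit) (hp : 1 ≤ maxCovers X) {ω K C : ℝ}
    (hK : kit.opTime I.maxRank ≤ K * (I.maxRank : ℝ) ^ ω) (hC : 144 * K ≤ C) :
    (out.time : ℝ) ≤ C * Fintype.card X * maxCovers X * I.critSq {q | q ∈ out.pairs} *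
      (I.maxRank : ℝ) ^ ω := by
  calc (out.time : ℝ) ≤ 144 * (Fintype.card X * maxCovers X * I.critSq {q | q ∈ out.pairs} *
        kit.opTime I.maxRank) := mod_cast h.time_le_mul hp
    _ ≤ 144 * (Fintype.card X * maxCovers X * I.critSq {q | q ∈ out.pairs} *
        (K * (I.maxRank : ℝ) ^ ω)) := by gcongr
    _ = 144 * K * (Fintype.card X * maxCovers X * I.critSq {q | q ∈ out.pairs} *
        (I.maxRank : ℝ) ^ ω) := by ring
    _ ≤ C * (Fintype.card X * maxCovers X * I.critSq {q | q ∈ out.pairs} *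
        (I.maxRank : ℝ) ^ ω) := by gcongr
    _ = _ := by ring

theorem mem_le_mul_sq (h : out.IsFinal I kit) (hp : 1 ≤ maxCovers X) (hd : 1 ≤ I.maxRank)
    {C : ℝ} (hC : 768 ≤ C) :
    (out.mem : ℝ) ≤ C * Fintype.card X ^ 2 * maxCovers X * I.maxRank ^ 2 :=
  calc (out.mem : ℝ) ≤ 768 * (Fintype.card X ^ 2 * maxCovers X * I.maxRank ^ 2) :=
        mod_cast h.mem_le_mul hp hd
    _ ≤ C * (Fintype.card X ^ 2 * maxCovers X * I.maxRank ^ 2) := by gcongr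
    _ = _ := by ring

theorem mem_add_work_le_mul_sq (h : out.IsFinal I kit) (hp : 1 ≤ maxCovers X)
    (hd : 1 ≤ I.maxRank) {W : ℕ} (hW : kit.HasWorkspace W) {C : ℝ}
    (hC : 768 + (kit.mulRegs 0 : ℝ) ≤ C) :
    ((out.mem + out.work : ℕ) : ℝ) ≤
      (C + W) * Fintype.card X ^ 2 * maxCovers X * I.maxRank ^ 2 :=
  calc ((out.mem + out.work : ℕ) : ℝ) ≤ 768 * (Fintype.card X ^ 2 * maxCovers X * I.maxRank ^ 2) +
        (kit.mulRegs 0 + W) * (Fintype.card X ^ 2 * maxCovers X * I.maxRank ^ 2) :=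
        mod_cast Nat.add_le_add (h.mem_le_mul hp hd) (h.work_le_mul hp hd hW)
    _ = (768 + kit.mulRegs 0 + W) * (Fintype.card X ^ 2 * maxCovers X * I.maxRank ^ 2) := by ring
    _ ≤ (C + W) * (Fintype.card X ^ 2 * maxCovers X * I.maxRank ^ 2) := by gcongr
    _ = _ := by ring

end Store.IsFinal

end Scythe

end

theorem theorem4p1 {R : Type u} [Ring R] (kit : MatrixKit R) (ω : ℝ)
    (hω : kit.HasExponent ω) :
    ∃ C : ℝ, ∀ (X : Type v) [PartialOrder X] [Fintype X] [DecidableEq X]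
      (I : Input.{u, v, w} R X),
      ∃ (N : ℕ) (out : Store R X I.rank) (S : Set (X × X)),
        -- the algorithm terminates; `S` is the set of pairs passed to `ReducePair`
        I.scythe kit N = some out ∧ S = {q | q ∈ out.pairs} ∧
        -- `S` is an acyclic matching on `X`, compatible with the parametrization
        IsAcyclicMatching S ∧ IsCompatible I.F.toBlockData S ∧
        -- what is left of `X` are the critical elements, with the Morse covering relation
        (∀ x, out.alive x = true ↔ IsCritical S x) ∧
        (∀ x, out.crit x = true ↔ IsCritical S x) ∧
        (∀ m m', IsCritical S m → IsCritical S m' →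
          (m' ∈ out.up m ↔ MorseCovers S m m') ∧ (m ∈ out.down m' ↔ MorseCovers S m m') ∧
          ((out.blk m m').isSome = true ↔ MorseCovers S m m')) ∧
        IsPartialOrder {m : X // IsCritical S m} (MorseLE S) ∧
        (∀ m m', MorseCovers S m m' → I.dim m' = I.dim m + 1) ∧
        -- the stored matrices are those of the Morse parametrization
        (∀ m m', IsCritical S m → IsCritical S m' →
          out.getBlk m m' = I.matrixOf (morseMap I.F.toBlockData S m m')) ∧
        (morseData I.F.toBlockData S).IsCochainComplex (fun m => I.dim m.1) ∧
        -- time and space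
        (1 ≤ maxCovers X → 1 ≤ I.maxRank →
          (out.time : ℝ) ≤ C * Fintype.card X * maxCovers X * I.critSq S *
            (I.maxRank : ℝ) ^ ω ∧
          (out.mem : ℝ) ≤ C * Fintype.card X ^ 2 * maxCovers X * I.maxRank ^ 2 ∧
          ∀ W : ℕ, kit.HasWorkspace W →
            ((out.mem + out.work : ℕ) : ℝ) ≤
              (C + W) * Fintype.card X ^ 2 * maxCovers X * I.maxRank ^ 2) := by
  obtain ⟨K, hK₀, hK⟩ := hω.exists_opTime_le
  refine ⟨144 * K + 768 + kit.mulRegs 0, fun X _ _ _ I => ?_⟩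
  obtain ⟨N, out, hout, h⟩ := I.exists_scythe_eq_some kit
  have hdim (m m' : X) : MorseCovers {q | q ∈ out.pairs} m m' → I.dim m' = I.dim m + 1 :=
    h.seq.dim_of_morseCovers I.dim_covBy
  refine ⟨N, out, {q | q ∈ out.pairs}, hout, rfl, h.seq.isAcyclicMatching, h.seq.isCompatible,
    h.alive_iff, h.crit_iff, fun m m' hm hm' => ?_, ?_, hdim,
    fun m m' hm hm' => h.getBlk_eq m m' ((h.alive_iff m).2 hm) ((h.alive_iff m').2 hm'),
    h.seq.isCochainComplex_morseData I.dim_covBy I.F.map_eq_zero I.F.isCochainComplex, ?_⟩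
  · have hblk := h.isSome_blk_iff hm hm'
    exact ⟨(h.mem_up m m').trans hblk, (h.mem_down m m').trans hblk, hblk⟩
  · exact isPartialOrder_morseLE fun m m' hmm' =>
      (Nat.lt_succ_self _).trans_eq (hdim m m' hmm').symm
  · intro hp hd
    have : (0 : ℝ) ≤ kit.mulRegs 0 := Nat.cast_nonneg _
    exact ⟨h.time_le_mul_rpow hp (hK _ hd) (by linarith), h.mem_le_mul_sq hp hd (by linarith),
      fun W hW => h.mem_add_work_le_mul_sq hp hd hW (by linarith)⟩
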